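/- Let $M$ be a smooth $4$-dimensional manifold. A \emph{Finsler spacetime} $(M,\mathcal A,F)$ consists of an open conic subset $\mathcal A\subset TM$ with non-empty fibers ($(x,y)\in\mathcal A$ and $\lambda>0$ imply $(x,\lambda y)\in\mathcal A$) and a smooth function $F:\mathcal A\to[0,\infty)$ with $F(x,\lambda y)=\lambda F(x,y)$ for $\lambda>0$, whose fundamental tensor $g_{ij}=\bar\partial_i\bar\partial_j\left(\tfrac12F^2\right)$ has Lorentzian signature on $\mathcal A$ (in either sign convention). Here $(x,y)$ are the coordinates of $TM$ induced by a chart of $M$, $\partial_i=\partial/\partial x^i$ and $\bar\partial_i=\partial/\partial y^i$. Put $$N^i_j=\tfrac14\bar\partial_j\Big(g^{ik}\big(y^l\partial_l\bar\partial_kF^2-\partial_kF^2\big)\Big),\qquad \delta_i=\partial_i-N^k_i\bar\partial_k,\qquad R^i{}_{jk}=\delta_jN^i_k-\delta_kN^i_j,$$ $$\mathrm{Ric}=R^i{}_{ij}\,y^j,\qquad R_{ij}=\tfrac12\bar\partial_i\bar\partial_j\mathrm{Ric}.$$ The spacetime is of \emph{Berwald type} if in every chart there are functions $\Gamma^i_{jk}(x)$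 with $N^i_j(x,y)=\Gamma^i_{jk}(x)y^k$ on $\mathcal A$. It is a \emph{Randers spacetime}, $F=\alpha+\beta$, if there are a smooth Lorentzian metric $a$ and a smooth $1$-form $b$ on $M$ such that on $\mathcal A$ one has $a_{ij}(x)y^iy^j>0$ and $F(x,y)=\alpha(x,y)+\beta(x,y)$ with $\alpha=\sqrt{a_{ij}(x)y^iy^j}$ and $\beta=b_i(x)y^i$. The vacuum Finsler gravity equation for spacetimes of Berwald type is $$\Big(g^{ij}-\frac{3}{F^2}\,y^iy^j\Big)R_{ij}=0\qquad\text{on }\mathcal A.$$ \textbf{Theorem.} Let $(M,\mathcal A,F)$, $F=\alpha+\beta$, be a Randers spacetime of Berwald type. Then $F$ solves the vacuum Finsler gravity equation if and only if the Lorentzian metric $a$ defining $\alpha$ solves the vacuum Einstein equations, i.e. the Ricci tensor of the Levi-Civita connection of $a$ vanishes on $M$. -/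

import Mathlib

open scoped Manifold ContDiff

noncomputable section

namespace FinslerGravity

/-- The coordinate space of a four-dimensional manifold. -/
abbrev E4 := EuclideanSpace ℝ (Fin 4)

-- `E4` carries its standard smooth structure, with the identity as its only chart.
attribute [local instance 2000] chartedSpaceSelf

/-! ### Calculus in local coordinates `(x, y)` of the tangent bundle -/

/-- A function of the bundle coordinates `(x, y)`. -/
abbrev LocalFun := E4 → E4 → ℝ

/-- The partial derivative `∂ᵢ f = ∂f/∂xⁱ` with respect to the position. -/
def dx (i : Fin 4) (f : LocalFun) : LocalFun :=
  fun x y => fderiv ℝ (fun x' => f x' y) x (EuclideanSpace.single i 1)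

/-- The partial derivative `∂̄ᵢ f = ∂f/∂yⁱ` with respect to the direction. -/
def dy (i : Fin 4) (f : LocalFun) : LocalFun :=
  fun x y => fderiv ℝ (fun y' => f x y') y (EuclideanSpace.single i 1)

/-- The partial derivative `∂ᵢ f` of a function of the position only. -/
def partialDeriv (i : Fin 4) (f : E4 → ℝ) : E4 → ℝ :=
  fun x => fderiv ℝ f x (EuclideanSpace.single i 1)

/-- A real `4 × 4` matrix is Lorentzian if it is congruent to `diag(1, -1, -1, -1)` or to
`diag(-1, 1, 1, 1)` (both sign conventions are allowed). -/
def IsLorentzianMatrix (B : Matrix (Fin 4) (Fin 4) ℝ) : Prop :=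
  ∃ P : Matrix (Fin 4) (Fin 4) ℝ, IsUnit P.det ∧
    (P.transpose * B * P = Matrix.diagonal ![1, -1, -1, -1] ∨
      P.transpose * B * P = Matrix.diagonal ![-1, 1, 1, 1])

/-! ### Finsler geometry in local coordinates; `F` is the local Finsler function -/

/-- The fundamental tensor `g_ij = ∂̄ᵢ ∂̄ⱼ (F² / 2)`. -/
def fundamentalTensor (F : LocalFun) (x y : E4) : Matrix (Fin 4) (Fin 4) ℝ :=
  Matrix.of fun i j => dy i (dy j (fun x' y' => (1 / 2) * F x' y' ^ 2)) x y

/-- The Cartan non-linear connection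
`Nⁱⱼ = (1/4) ∂̄ⱼ (gⁱᵏ (yˡ ∂ₗ ∂̄ₖ F² - ∂ₖ F²))`. -/
def cartanConnection (F : LocalFun) (i j : Fin 4) : LocalFun :=
  fun x y => (1 / 4) * dy j (fun x' y' => ∑ k, (fundamentalTensor F x' y')⁻¹ i k *
    ((∑ l, y' l * dx l (dy k (fun x'' y'' => F x'' y'' ^ 2)) x' y') -
      dx k (fun x'' y'' => F x'' y'' ^ 2) x' y')) x y

/-- The horizontal derivative `δᵢ f = ∂ᵢ f - Nᵏᵢ ∂̄ₖ f`. -/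
def horizontalDeriv (F : LocalFun) (i : Fin 4) (f : LocalFun) : LocalFun :=
  fun x y => dx i f x y - ∑ k, cartanConnection F k i x y * dy k f x y

/-- The curvature `Rⁱⱼₖ = δⱼ Nⁱₖ - δₖ Nⁱⱼ` of the Cartan non-linear connection. -/
def nonlinearCurvature (F : LocalFun) (i j k : Fin 4) : LocalFun :=
  fun x y => horizontalDeriv F j (cartanConnection F i k) x y -
    horizontalDeriv F k (cartanConnection F i j) x y

/-- The curvature scalar `Ric = Rⁱᵢⱼ yʲ`. -/
def finslerRic (F : LocalFun) : LocalFun :=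
  fun x y => ∑ i, ∑ j, nonlinearCurvature F i i j x y * y j

/-- The Finsler Ricci tensor `R_ij = (1/2) ∂̄ᵢ ∂̄ⱼ Ric`. -/
def finslerRicci (F : LocalFun) (i j : Fin 4) : LocalFun :=
  fun x y => (1 / 2) * dy i (dy j (finslerRic F)) x y

/-- The left-hand side `(gⁱʲ - (3 / F²) yⁱ yʲ) R_ij` of the vacuum field equation of Finsler gravity
(for Berwald spacetimes). -/
def fieldOperator (F : LocalFun) : LocalFun :=
  fun x y => ∑ i, ∑ j, ((fundamentalTensor F x y)⁻¹ i j - 3 / F x y ^ 2 * (y i * y j)) *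
    finslerRicci F i j x y

/-! ### Pseudo-Riemannian geometry in local coordinates; `a` is the local metric `a_ij(x)` -/

/-- The Christoffel symbols
`Γⁱⱼₖ = (1/2) aⁱˡ (∂ⱼ a_lk + ∂ₖ a_lj - ∂ₗ a_jk)` of the Levi-Civita connection. -/
def christoffel (a : E4 → Matrix (Fin 4) (Fin 4) ℝ) (i j k : Fin 4) : E4 → ℝ :=
  fun x => (1 / 2) * ∑ l, (a x)⁻¹ i l *
    (partialDeriv j (fun x' => a x' l k) x + partialDeriv k (fun x' => a x' l j) x -
      partialDeriv l (fun x' => a x' j k) x)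

/-- The Riemann curvature tensor
`R̄ₗⁱⱼₖ = ∂ⱼ Γⁱₖₗ - ∂ₖ Γⁱⱼₗ + Γⁱₘⱼ Γᵐₖₗ - Γⁱₘₖ Γᵐⱼₗ`. -/
def riemannCurvature (a : E4 → Matrix (Fin 4) (Fin 4) ℝ) (l i j k : Fin 4) : E4 → ℝ :=
  fun x => partialDeriv j (christoffel a i k l) x - partialDeriv k (christoffel a i j l) x +
    ∑ m, (christoffel a i m j x * christoffel a m k l x -
      christoffel a i m k x * christoffel a m j l x)

/-- The Ricci tensor `R̄ₗₖ = R̄ₗⁱᵢₖ`. -/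
def ricci (a : E4 → Matrix (Fin 4) (Fin 4) ℝ) (l k : Fin 4) : E4 → ℝ :=
  fun x => ∑ i, riemannCurvature a l i i k x

/-! ### Manifolds -/

section Manifold

variable {M : Type*} [TopologicalSpace M] [ChartedSpace E4 M]

/-- The tangent vector `yⁱ ∂ᵢ` at the point with coordinates `x` in the chart `φ`. -/
def coordVector (φ : OpenPartialHomeomorph M E4) (x y : E4) :
    TangentSpace 𝓘(ℝ, E4) (φ.symm x) :=
  mfderiv 𝓘(ℝ, E4) 𝓘(ℝ, E4) φ.symm x y

/-- The point of the tangent bundle with the bundle coordinates `(x, y)` induced by the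
chart `φ`. -/
def coordPoint (φ : OpenPartialHomeomorph M E4) (x y : E4) : TangentBundle 𝓘(ℝ, E4) M :=
  ⟨φ.symm x, coordVector φ x y⟩

/-- The expression of a function on the tangent bundle in the bundle coordinates induced by the
chart `φ`. -/
def localExpr (φ : OpenPartialHomeomorph M E4) (F : TangentBundle 𝓘(ℝ, E4) M → ℝ) : LocalFun :=
  fun x y => F (coordPoint φ x y)

variable [IsManifold 𝓘(ℝ, E4) ∞ M]

/-- The component matrix `a_ij = a(∂ᵢ, ∂ⱼ)` of a `(0,2)`-tensor field in the chart `φ`. -/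
def localMetric (φ : OpenPartialHomeomorph M E4)
    (a : ∀ p : M, TangentSpace 𝓘(ℝ, E4) p →L[ℝ] TangentSpace 𝓘(ℝ, E4) p →L[ℝ] ℝ)
    (x : E4) : Matrix (Fin 4) (Fin 4) ℝ :=
  Matrix.of fun i j => a (φ.symm x)
    (coordVector φ x (EuclideanSpace.single i 1)) (coordVector φ x (EuclideanSpace.single j 1))

variable (M)

/-- A smooth Lorentzian metric on the four-dimensional smooth manifold `M`. -/
structure LorentzianMetric where
  /-- The bilinear form on each tangent space. -/
  val : ∀ p : M, TangentSpace 𝓘(ℝ, E4) p →L[ℝ] TangentSpace 𝓘(ℝ, E4) p →L[ℝ] ℝ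
  symm : ∀ (p : M) (v w : TangentSpace 𝓘(ℝ, E4) p), val p v w = val p w v
  smooth : ContMDiff 𝓘(ℝ, E4) (𝓘(ℝ, E4).prod 𝓘(ℝ, E4 →L[ℝ] E4 →L[ℝ] ℝ)) ∞
    (fun p => Bundle.TotalSpace.mk' (E4 →L[ℝ] E4 →L[ℝ] ℝ) p (val p))
  lorentzian : ∀ φ ∈ IsManifold.maximalAtlas 𝓘(ℝ, E4) ∞ M, ∀ x ∈ φ.target,
    IsLorentzianMatrix (localMetric φ val x)

/-- A smooth 1-form on the smooth manifold `M`. -/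
structure OneForm where
  /-- The linear form on each tangent space. -/
  val : ∀ p : M, TangentSpace 𝓘(ℝ, E4) p →L[ℝ] ℝ
  smooth : ContMDiff 𝓘(ℝ, E4) (𝓘(ℝ, E4).prod 𝓘(ℝ, E4 →L[ℝ] ℝ)) ∞
    (fun p => Bundle.TotalSpace.mk' (E4 →L[ℝ] ℝ) p (val p))

/-- A four-dimensional Finsler spacetime `(M, 𝒜, F)`: `𝒜` is an open conic subset of `TM` with
non-empty fibers, and `F : 𝒜 → [0, ∞)` is smooth, positively homogeneous of degree one, and has a
fundamental tensor of Lorentzian signature. The values of `F` outside `𝒜` play no role. -/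
structure FinslerSpacetime where
  /-- The conic domain `𝒜`. -/
  domain : Set (TangentBundle 𝓘(ℝ, E4) M)
  isOpen_domain : IsOpen domain
  nonempty_fiber : ∀ p : M, ∃ v : TangentSpace 𝓘(ℝ, E4) p,
    (⟨p, v⟩ : TangentBundle 𝓘(ℝ, E4) M) ∈ domain
  conic : ∀ (p : M) (v : TangentSpace 𝓘(ℝ, E4) p) (c : ℝ), 0 < c →
    (⟨p, v⟩ : TangentBundle 𝓘(ℝ, E4) M) ∈ domain →
    (⟨p, c • v⟩ : TangentBundle 𝓘(ℝ, E4) M) ∈ domain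
  /-- The Finsler function `F`. -/
  F : TangentBundle 𝓘(ℝ, E4) M → ℝ
  nonneg : ∀ z ∈ domain, 0 ≤ F z
  smooth : ContMDiffOn 𝓘(ℝ, E4).tangent 𝓘(ℝ, ℝ) ∞ F domain
  homogeneous : ∀ (p : M) (v : TangentSpace 𝓘(ℝ, E4) p) (c : ℝ), 0 < c →
    (⟨p, v⟩ : TangentBundle 𝓘(ℝ, E4) M) ∈ domain → F ⟨p, c • v⟩ = c * F ⟨p, v⟩
  lorentzian : ∀ φ ∈ IsManifold.maximalAtlas 𝓘(ℝ, E4) ∞ M, ∀ x ∈ φ.target, ∀ y : E4,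
    coordPoint φ x y ∈ domain → IsLorentzianMatrix (fundamentalTensor (localExpr φ F) x y)

variable {M}

/-- The Finsler spacetime is of Randers type, `F = α + β` on `𝒜`, with `α(v) = √(a(v, v))` for the
Lorentzian metric `a` and `β(v) = b(v)` for the 1-form `b`; in particular `a(v, v) > 0` on `𝒜`, so
that `α` is real and non-vanishing there. -/
def FinslerSpacetime.IsRanders (S : FinslerSpacetime M) (a : LorentzianMetric M) (b : OneForm M) :
    Prop :=
  ∀ (p : M) (v : TangentSpace 𝓘(ℝ, E4) p), (⟨p, v⟩ : TangentBundle 𝓘(ℝ, E4) M) ∈ S.domain →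
    0 < a.val p v v ∧ S.F ⟨p, v⟩ = Real.sqrt (a.val p v v) + b.val p v

/-- The Finsler spacetime is of Berwald type: in all local coordinates the Cartan non-linear
connection is linear, `Nⁱⱼ(x, y) = Γⁱⱼₖ(x) yᵏ` on `𝒜`. -/
def FinslerSpacetime.IsBerwald (S : FinslerSpacetime M) : Prop :=
  ∀ φ ∈ IsManifold.maximalAtlas 𝓘(ℝ, E4) ∞ M, ∃ Γ : Fin 4 → Fin 4 → Fin 4 → E4 → ℝ,
    ∀ x ∈ φ.target, ∀ y : E4, coordPoint φ x y ∈ S.domain → ∀ i j : Fin 4,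
      cartanConnection (localExpr φ S.F) i j x y = ∑ k, Γ i j k x * y k

/-- The Finsler function (of a spacetime of Berwald type) solves the vacuum field equation of
Finsler gravity, `(gⁱʲ - (3 / F²) yⁱ yʲ) R_ij = 0` on `𝒜`. -/
def FinslerSpacetime.SolvesVacuumFinslerGravity (S : FinslerSpacetime M) : Prop :=
  ∀ φ ∈ IsManifold.maximalAtlas 𝓘(ℝ, E4) ∞ M, ∀ x ∈ φ.target, ∀ y : E4,
    coordPoint φ x y ∈ S.domain → fieldOperator (localExpr φ S.F) x y = 0

/-- The Lorentzian metric solves the vacuum Einstein equations `R̄_ij = 0`. -/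
def LorentzianMetric.SolvesVacuumEinstein (a : LorentzianMetric M) : Prop :=
  ∀ φ ∈ IsManifold.maximalAtlas 𝓘(ℝ, E4) ∞ M, ∀ x ∈ φ.target, ∀ i j : Fin 4,
    ricci (localMetric φ a.val) i j x = 0

end Manifold

end FinslerGravity

end

open scoped Manifold ContDiff

noncomputable section

namespace FinslerGravity

/-! Everything is local, so a chart is fixed and `F = α + β` is studied in bundle coordinates.
Homogeneity makes `F` horizontally constant: `Nⁱⱼ ∂̄ᵢF = ∂ⱼF` (`sum_cartanConnection_mul_dy`). In
the Berwald case `N` is linear in `y`, and this identity, multiplied by `2α`, reads `P(y) + α Q(y) =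
0` with `P` quadratic and `Q` linear in `y`. Since `a` is indefinite, `α` is independent of the
analytic functions of `y` (`eq_zero_of_add_sqrt_mul`), so `P = Q = 0`: the connection `Γ` preserves
`a` and `b` separately (`parallel_aux`). It is torsion free, because `N` is a `y`-derivative of the
spray. Hence it is the Levi-Civita connection of `a`, and `b` is parallel.

It follows that the Finsler Ricci tensor is the Ricci tensor `S` of `a` (`finslerRicci_eq`), so
Einstein's equations trivially imply the Finsler equation.

Conversely, a parallel `b` annihilates the curvature, so its dual vector annihilates `S`
(`sum_mul_ricci`). With the explicit inverse of the fundamental tensor, the field equation involves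
only `tr S`, `S(y, y)`, `α`, `β` and the norm of `b` (`fieldOperator_eq`). Clearing denominators and
again separating the part with `α` from the part without gives, at each point, `(tr S) a = c S` with
`c = 1` if `b ≠ 0` and `c = 3` if `b = 0`. The trace of this is `(4 - c) tr S = 0`, whence `S = 0`.
-/

lemma contMDiff_const_section {E : Type*} [NormedAddCommGroup E] [NormedSpace ℝ E] (v : E) :
    ContMDiff 𝓘(ℝ, E) 𝓘(ℝ, E).tangent ∞ (fun x : E => (⟨x, v⟩ : TangentBundle 𝓘(ℝ, E) E)) := by
  intro x
  rw [Bundle.contMDiffAt_totalSpace]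
  refine ⟨contMDiffAt_id, ?_⟩
  simp
  exact contMDiffAt_const

attribute [local instance 2000] chartedSpaceSelf

/-- The quadratic form `a_ij y^i y^j`. -/
def quad (a : Matrix (Fin 4) (Fin 4) ℝ) (y : E4) : ℝ := ∑ i, ∑ j, a i j * (y i * y j)

/-- The linear form `b_i y^i`. -/
def lin (b : Fin 4 → ℝ) (y : E4) : ℝ := ∑ i, b i * y i

/-- The coordinate data of a Randers spacetime: `U` is the coordinate domain, `V` the set of bundle
coordinates of the conic domain. -/
structure IsRandersChart (U : Set E4) (V : Set (E4 × E4)) (a : E4 → Matrix (Fin 4) (Fin 4) ℝ)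
    (b : E4 → Fin 4 → ℝ) (F : LocalFun) : Prop where
  isOpen_base : IsOpen U
  isOpen_domain : IsOpen V
  mem_base : ∀ {x y}, (x, y) ∈ V → x ∈ U
  nonempty_fiber : ∀ x ∈ U, ∃ y, (x, y) ∈ V
  metric_smooth : ∀ i j, ContDiffOn ℝ ∞ (fun x => a x i j) U
  form_smooth : ∀ i, ContDiffOn ℝ ∞ (fun x => b x i) U
  metric_symm : ∀ x ∈ U, ∀ i j, a x i j = a x j i
  metric_lorentzian : ∀ x ∈ U, IsLorentzianMatrix (a x)
  quad_pos : ∀ {x y}, (x, y) ∈ V → 0 < quad (a x) y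
  eq_randers : ∀ {x y}, (x, y) ∈ V → F x y = Real.sqrt (quad (a x) y) + lin (b x) y
  lorentzian : ∀ {x y}, (x, y) ∈ V → IsLorentzianMatrix (fundamentalTensor F x y)

/-! ### From the manifold to bundle coordinates -/

section Manifold

variable {M : Type*} [TopologicalSpace M] [ChartedSpace E4 M]

lemma sum_smul_single (y : E4) : y = ∑ i, y i • (EuclideanSpace.single i (1 : ℝ) : E4) := by
  ext j
  simp [Finset.sum_apply, Pi.single_apply]

/-- The component `b_i = b(∂_i)` of a `1`-form in the chart `φ`. -/
def localForm (φ : OpenPartialHomeomorph M E4) (b : ∀ p : M, TangentSpace 𝓘(ℝ, E4) p →L[ℝ] ℝ)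
    (x : E4) (i : Fin 4) : ℝ :=
  b (φ.symm x) (coordVector φ x (EuclideanSpace.single i 1))

lemma coordVector_eq_sum (φ : OpenPartialHomeomorph M E4) (x y : E4) :
    coordVector φ x y = ∑ i, y i • coordVector φ x (EuclideanSpace.single i 1) := by
  unfold coordVector
  conv_lhs => rw [sum_smul_single y]
  erw [map_sum]
  refine Finset.sum_congr rfl fun i _ => ?_
  erw [map_smul]

lemma quad_localMetric (φ : OpenPartialHomeomorph M E4)
    (a : ∀ p : M, TangentSpace 𝓘(ℝ, E4) p →L[ℝ] TangentSpace 𝓘(ℝ, E4) p →L[ℝ] ℝ) (x y : E4) :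
    a (φ.symm x) (coordVector φ x y) (coordVector φ x y) = quad (localMetric φ a x) y := by
  rw [coordVector_eq_sum]
  simp only [map_sum, map_smul, sum_apply, smul_apply,
    smul_eq_mul, quad, localMetric, Matrix.of_apply, Finset.mul_sum]
  rw [Finset.sum_comm]
  refine Finset.sum_congr rfl fun i _ => Finset.sum_congr rfl fun j _ => ?_
  ring

lemma lin_localForm (φ : OpenPartialHomeomorph M E4)
    (b : ∀ p : M, TangentSpace 𝓘(ℝ, E4) p →L[ℝ] ℝ) (x y : E4) :
    b (φ.symm x) (coordVector φ x y) = lin (localForm φ b x) y := by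
  rw [coordVector_eq_sum]
  simp only [map_sum, map_smul, smul_eq_mul, lin, localForm]
  exact Finset.sum_congr rfl fun i _ => mul_comm _ _

lemma tangentMapWithin_symm (φ : OpenPartialHomeomorph M E4) {x : E4} (hx : x ∈ φ.target)
    (v : E4) : tangentMapWithin 𝓘(ℝ, E4) 𝓘(ℝ, E4) φ.symm φ.target ⟨x, v⟩ = coordPoint φ x v := by
  simp only [tangentMapWithin, coordPoint, coordVector, mfderivWithin_of_isOpen φ.open_target hx]

lemma surjective_coordVector {φ : OpenPartialHomeomorph M E4}
    (hφ : φ ∈ IsManifold.maximalAtlas 𝓘(ℝ, E4) ∞ M) {x : E4} (hx : x ∈ φ.target) :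
    Function.Surjective (coordVector φ x) := by
  have h : φ.MDifferentiable 𝓘(ℝ, E4) 𝓘(ℝ, E4) :=
    ⟨(contMDiffOn_of_mem_maximalAtlas hφ).mdifferentiableOn (by simp),
      (contMDiffOn_symm_of_mem_maximalAtlas hφ).mdifferentiableOn (by simp)⟩
  exact h.symm.mfderiv_surjective hx

variable [IsManifold 𝓘(ℝ, E4) ∞ M]

lemma continuousOn_coordPoint {φ : OpenPartialHomeomorph M E4}
    (hφ : φ ∈ IsManifold.maximalAtlas 𝓘(ℝ, E4) ∞ M) :
    ContinuousOn (fun p : E4 × E4 => coordPoint φ p.1 p.2) (φ.target ×ˢ Set.univ) := by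
  have h := contMDiffOn_symm_of_mem_maximalAtlas hφ
  have h2 := h.continuousOn_tangentMapWithin (by simp) φ.open_target.uniqueMDiffOn
  have h3 := (tangentBundleModelSpaceHomeomorph 𝓘(ℝ, E4)).symm.continuous
  refine (h2.comp (s := φ.target ×ˢ Set.univ) h3.continuousOn (fun p hp => hp.1)).congr
    fun p hp => (tangentMapWithin_symm φ hp.1 p.2).symm

lemma contMDiffOn_coordPoint_const {φ : OpenPartialHomeomorph M E4}
    (hφ : φ ∈ IsManifold.maximalAtlas 𝓘(ℝ, E4) ∞ M) (v : E4) :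
    ContMDiffOn 𝓘(ℝ, E4) 𝓘(ℝ, E4).tangent ∞ (fun x => coordPoint φ x v) φ.target := by
  have h := contMDiffOn_symm_of_mem_maximalAtlas hφ
  have h2 := h.contMDiffOn_tangentMapWithin (m := ∞) (by simp) φ.open_target.uniqueMDiffOn
  refine (h2.comp (s := φ.target) (contMDiff_const_section v).contMDiffOn (fun p hp => hp)).congr
    fun x hx => (tangentMapWithin_symm φ hx v).symm

lemma contDiffOn_localForm {φ : OpenPartialHomeomorph M E4}
    (hφ : φ ∈ IsManifold.maximalAtlas 𝓘(ℝ, E4) ∞ M) (b : OneForm M) (i : Fin 4) :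
    ContDiffOn ℝ ∞ (fun x => localForm φ b.val x i) φ.target := by
  rw [← contMDiffOn_iff_contDiffOn]
  intro x hx
  have hb := b.smooth.contMDiffAt.comp_contMDiffWithinAt x
    (contMDiffOn_symm_of_mem_maximalAtlas hφ x hx)
  have : ContMDiffWithinAt 𝓘(ℝ, E4) (𝓘(ℝ, E4).prod 𝓘(ℝ)) ∞
      (fun x => Bundle.TotalSpace.mk' ℝ (E := Bundle.Trivial M ℝ) (φ.symm x)
        (localForm φ b.val x i)) φ.target x := by
    apply ContMDiffWithinAt.clm_bundle_apply (𝕜 := ℝ) (F₂ := ℝ)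
      (E₂ := Bundle.Trivial M ℝ) (F₁ := E4) (E₁ := TangentSpace (M := M) 𝓘(ℝ, E4))
      (v := fun x => coordVector φ x (EuclideanSpace.single i 1))
      (ϕ := fun x => b.val (φ.symm x))
    · exact hb
    · exact contMDiffOn_coordPoint_const hφ _ x hx
  rw [Bundle.contMDiffWithinAt_totalSpace] at this
  exact this.2

lemma contDiffOn_localMetric {φ : OpenPartialHomeomorph M E4}
    (hφ : φ ∈ IsManifold.maximalAtlas 𝓘(ℝ, E4) ∞ M) (a : LorentzianMetric M) (i j : Fin 4) :
    ContDiffOn ℝ ∞ (fun x => localMetric φ a.val x i j) φ.target := by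
  rw [← contMDiffOn_iff_contDiffOn]
  intro x hx
  have ha := a.smooth.contMDiffAt.comp_contMDiffWithinAt x
    (contMDiffOn_symm_of_mem_maximalAtlas hφ x hx)
  have : ContMDiffWithinAt 𝓘(ℝ, E4) (𝓘(ℝ, E4).prod 𝓘(ℝ)) ∞
      (fun x => Bundle.TotalSpace.mk' ℝ (E := Bundle.Trivial M ℝ) (φ.symm x)
        (localMetric φ a.val x i j)) φ.target x := by
    apply ContMDiffWithinAt.clm_bundle_apply₂ (𝕜 := ℝ) (F₃ := ℝ)
      (E₃ := Bundle.Trivial M ℝ) (F₁ := E4) (E₁ := TangentSpace (M := M) 𝓘(ℝ, E4))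
      (F₂ := E4) (E₂ := TangentSpace (M := M) 𝓘(ℝ, E4))
      (v := fun x => coordVector φ x (EuclideanSpace.single i 1))
      (w := fun x => coordVector φ x (EuclideanSpace.single j 1))
      (ψ := fun x => a.val (φ.symm x))
    · exact ha
    · exact contMDiffOn_coordPoint_const hφ _ x hx
    · exact contMDiffOn_coordPoint_const hφ _ x hx
  rw [Bundle.contMDiffWithinAt_totalSpace] at this
  exact this.2

/-- Passage from the manifold to coordinates: the later local arguments use only this data. The
fibres stay non-empty because the differential of an inverse chart is surjective. -/
lemma isRandersChart (S : FinslerSpacetime M) (a : LorentzianMetric M) (b : OneForm M)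
    (hS : S.IsRanders a b) {φ : OpenPartialHomeomorph M E4}
    (hφ : φ ∈ IsManifold.maximalAtlas 𝓘(ℝ, E4) ∞ M) :
    IsRandersChart φ.target {p | p.1 ∈ φ.target ∧ coordPoint φ p.1 p.2 ∈ S.domain}
      (localMetric φ a.val) (localForm φ b.val) (localExpr φ S.F) where
  isOpen_base := φ.open_target
  isOpen_domain := by
    have := (continuousOn_coordPoint hφ).isOpen_inter_preimage
      (φ.open_target.prod isOpen_univ) S.isOpen_domain
    convert this using 1
    ext p
    simp
  mem_base h := h.1
  nonempty_fiber x hx := by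
    obtain ⟨v, hv⟩ := S.nonempty_fiber (φ.symm x)
    obtain ⟨y, rfl⟩ := surjective_coordVector hφ hx v
    exact ⟨y, hx, hv⟩
  metric_smooth := contDiffOn_localMetric hφ a
  form_smooth := contDiffOn_localForm hφ b
  metric_symm x _ i j := a.symm _ _ _
  metric_lorentzian := a.lorentzian φ hφ
  quad_pos {x y} h := by
    rw [← quad_localMetric]
    exact (hS _ _ h.2).1
  eq_randers {x y} h := by
    rw [← quad_localMetric, ← lin_localForm]
    exact (hS _ _ h.2).2
  lorentzian {x y} h := S.lorentzian φ hφ x h.1 y h.2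

end Manifold

/-- Smoothness of a function of the bundle coordinates on a set. -/
def SmoothOn (V : Set (E4 × E4)) (f : LocalFun) : Prop :=
  ContDiffOn ℝ ∞ (fun p : E4 × E4 => f p.1 p.2) V

/-! ### Partial derivatives of smooth functions of `(x, y)` -/

section Calculus

variable {V : Set (E4 × E4)} {f g : LocalFun} {x y : E4}

lemma SmoothOn.add (hf : SmoothOn V f) (hg : SmoothOn V g) :
    SmoothOn V (fun x y => f x y + g x y) := ContDiffOn.add hf hg

lemma SmoothOn.sub (hf : SmoothOn V f) (hg : SmoothOn V g) :
    SmoothOn V (fun x y => f x y - g x y) := ContDiffOn.sub hf hg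

lemma SmoothOn.mul (hf : SmoothOn V f) (hg : SmoothOn V g) :
    SmoothOn V (fun x y => f x y * g x y) := ContDiffOn.mul hf hg

lemma SmoothOn.pow (hf : SmoothOn V f) (n : ℕ) : SmoothOn V (fun x y => f x y ^ n) :=
  ContDiffOn.pow hf n

lemma SmoothOn.sum {ι : Type*} {s : Finset ι} {f : ι → LocalFun}
    (hf : ∀ i ∈ s, SmoothOn V (f i)) : SmoothOn V (fun x y => ∑ i ∈ s, f i x y) :=
  ContDiffOn.sum hf

lemma SmoothOn.const (c : ℝ) : SmoothOn V (fun _ _ => c) := contDiffOn_const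

lemma SmoothOn.coord (i : Fin 4) : SmoothOn V (fun _ y => y i) :=
  ContDiff.contDiffOn (by fun_prop)

lemma SmoothOn.base {U : Set E4} {f : E4 → ℝ} (hf : ContDiffOn ℝ ∞ f U)
    (hV : ∀ {x y}, (x, y) ∈ V → x ∈ U) : SmoothOn V (fun x _ => f x) :=
  ContDiffOn.comp hf contDiff_fst.contDiffOn fun _ hp => hV hp

lemma SmoothOn.congr (hf : SmoothOn V f) (h : ∀ {x y}, (x, y) ∈ V → g x y = f x y) :
    SmoothOn V g := ContDiffOn.congr hf fun _ hp => h hp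

lemma SmoothOn.sqrt (hf : SmoothOn V f) (h : ∀ {x y}, (x, y) ∈ V → 0 < f x y) :
    SmoothOn V (fun x y => Real.sqrt (f x y)) :=
  ContDiffOn.sqrt hf fun _ hp => (h hp).ne'

variable (hV : IsOpen V)
include hV

lemma SmoothOn.differentiableAt (hf : SmoothOn V f) (h : (x, y) ∈ V) :
    DifferentiableAt ℝ (fun p : E4 × E4 => f p.1 p.2) (x, y) :=
  (ContDiffOn.contDiffAt hf (hV.mem_nhds h)).differentiableAt (by simp)

lemma SmoothOn.differentiableAt_left (hf : SmoothOn V f) (h : (x, y) ∈ V) :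
    DifferentiableAt ℝ (fun x' => f x' y) x :=
  DifferentiableAt.comp (g := fun p : E4 × E4 => f p.1 p.2) x (hf.differentiableAt hV h)
    (f := fun x' => (x', y)) (by fun_prop)

lemma SmoothOn.differentiableAt_right (hf : SmoothOn V f) (h : (x, y) ∈ V) :
    DifferentiableAt ℝ (fun y' => f x y') y :=
  DifferentiableAt.comp (g := fun p : E4 × E4 => f p.1 p.2) y (hf.differentiableAt hV h)
    (f := fun y' => (x, y')) (by fun_prop)

/-- Partial derivatives are defined on slices; expressing them through the joint derivative is what
yields their smoothness and the commutation of mixed derivatives. -/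
lemma SmoothOn.dx_eq (hf : SmoothOn V f) (h : (x, y) ∈ V) (i : Fin 4) :
    dx i f x y = fderiv ℝ (fun p : E4 × E4 => f p.1 p.2) (x, y) (EuclideanSpace.single i 1, 0) := by
  have h1 := (hf.differentiableAt hV h).hasFDerivAt.comp x
    (f := fun x' => (x', y)) ((hasFDerivAt_id x).prodMk (hasFDerivAt_const y x))
  unfold dx
  erw [h1.fderiv]
  simp

lemma SmoothOn.dy_eq (hf : SmoothOn V f) (h : (x, y) ∈ V) (i : Fin 4) :
    dy i f x y = fderiv ℝ (fun p : E4 × E4 => f p.1 p.2) (x, y) (0, EuclideanSpace.single i 1) := by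
  have h1 := (hf.differentiableAt hV h).hasFDerivAt.comp y
    (f := fun y' => (x, y')) ((hasFDerivAt_const x y).prodMk (hasFDerivAt_id y))
  unfold dy
  erw [h1.fderiv]
  simp

lemma SmoothOn.dx (hf : SmoothOn V f) (i : Fin 4) : SmoothOn V (dx i f) := by
  have h := ContDiffOn.fderiv_of_isOpen (m := ∞) hf hV (by simp)
  exact (h.clm_apply contDiffOn_const).congr fun p hp => hf.dx_eq hV hp i

lemma SmoothOn.dy (hf : SmoothOn V f) (i : Fin 4) : SmoothOn V (dy i f) := by
  have h := ContDiffOn.fderiv_of_isOpen (m := ∞) hf hV (by simp)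
  exact (h.clm_apply contDiffOn_const).congr fun p hp => hf.dy_eq hV hp i

lemma eventually_left (h : (x, y) ∈ V) : ∀ᶠ x' in nhds x, (x', y) ∈ V :=
  (Continuous.prodMk_left y).continuousAt.eventually_mem (hV.mem_nhds h)

lemma eventually_right (h : (x, y) ∈ V) : ∀ᶠ y' in nhds y, (x, y') ∈ V :=
  (Continuous.prodMk_right x).continuousAt.eventually_mem (hV.mem_nhds h)

lemma dx_congr (hfg : ∀ {x y}, (x, y) ∈ V → f x y = g x y) (h : (x, y) ∈ V) (i : Fin 4) :
    dx i f x y = dx i g x y := by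
  unfold dx
  rw [Filter.EventuallyEq.fderiv_eq ((eventually_left hV h).mono fun _ h => hfg h)]

lemma dy_congr (hfg : ∀ {x y}, (x, y) ∈ V → f x y = g x y) (h : (x, y) ∈ V) (i : Fin 4) :
    dy i f x y = dy i g x y := by
  unfold dy
  rw [Filter.EventuallyEq.fderiv_eq ((eventually_right hV h).mono fun _ h => hfg h)]

lemma SmoothOn.fderiv_fderiv (hf : SmoothOn V f) (h : (x, y) ∈ V) (v w : E4 × E4) :
    fderiv ℝ (fun p => fderiv ℝ (fun p : E4 × E4 => f p.1 p.2) p v) (x, y) w =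
      fderiv ℝ (fun p => fderiv ℝ (fun p : E4 × E4 => f p.1 p.2) p w) (x, y) v := by
  have h1 : ContDiffAt ℝ ∞ (fun p : E4 × E4 => f p.1 p.2) (x, y) :=
    ContDiffOn.contDiffAt hf (hV.mem_nhds h)
  have h2 := h1.isSymmSndFDerivAt (by simpa using WithTop.coe_le_coe.2 (le_top (a := (2 : ℕ∞))))
  have h3 : DifferentiableAt ℝ (fderiv ℝ (fun p : E4 × E4 => f p.1 p.2)) (x, y) :=
    (h1.fderiv_right (m := ∞) (by simp)).differentiableAt (by simp)
  have h4 : ∀ u : E4 × E4, fderiv ℝ (fun p => fderiv ℝ (fun p : E4 × E4 => f p.1 p.2) p u) (x, y) =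
      (fderiv ℝ (fderiv ℝ (fun p : E4 × E4 => f p.1 p.2)) (x, y)).flip u := fun u => by
    have := (h3.hasFDerivAt.clm_apply (hasFDerivAt_const u (x, y))).fderiv
    simpa using this
  rw [h4, h4]
  exact h2 w v

lemma SmoothOn.dy_dx (hf : SmoothOn V f) (h : (x, y) ∈ V) (i j : Fin 4) :
    FinslerGravity.dy i (FinslerGravity.dx j f) x y =
      FinslerGravity.dx j (FinslerGravity.dy i f) x y := by
  rw [(hf.dx hV j).dy_eq hV h, (hf.dy hV i).dx_eq hV h]
  have e1 : (fun p : E4 × E4 => FinslerGravity.dx j f p.1 p.2) =ᶠ[nhds (x, y)] _ :=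
    Filter.eventuallyEq_of_mem (hV.mem_nhds h) fun p hp => hf.dx_eq hV hp j
  have e2 : (fun p : E4 × E4 => FinslerGravity.dy i f p.1 p.2) =ᶠ[nhds (x, y)] _ :=
    Filter.eventuallyEq_of_mem (hV.mem_nhds h) fun p hp => hf.dy_eq hV hp i
  rw [e1.fderiv_eq, e2.fderiv_eq]
  exact hf.fderiv_fderiv hV h _ _

lemma SmoothOn.dy_dy (hf : SmoothOn V f) (h : (x, y) ∈ V) (i j : Fin 4) :
    FinslerGravity.dy i (FinslerGravity.dy j f) x y =
      FinslerGravity.dy j (FinslerGravity.dy i f) x y := by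
  rw [(hf.dy hV j).dy_eq hV h, (hf.dy hV i).dy_eq hV h]
  have e1 : ∀ i, (fun p : E4 × E4 => FinslerGravity.dy i f p.1 p.2) =ᶠ[nhds (x, y)] _ := fun i =>
    Filter.eventuallyEq_of_mem (hV.mem_nhds h) fun p hp => hf.dy_eq hV hp i
  rw [(e1 i).fderiv_eq, (e1 j).fderiv_eq]
  exact hf.fderiv_fderiv hV h _ _

lemma dx_add (hf : SmoothOn V f) (hg : SmoothOn V g) (h : (x, y) ∈ V) (i : Fin 4) :
    dx i (fun x y => f x y + g x y) x y = dx i f x y + dx i g x y := by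
  unfold dx
  rw [fderiv_fun_add (hf.differentiableAt_left hV h) (hg.differentiableAt_left hV h)]
  rfl

lemma dy_add (hf : SmoothOn V f) (hg : SmoothOn V g) (h : (x, y) ∈ V) (i : Fin 4) :
    dy i (fun x y => f x y + g x y) x y = dy i f x y + dy i g x y := by
  unfold dy
  rw [fderiv_fun_add (hf.differentiableAt_right hV h) (hg.differentiableAt_right hV h)]
  rfl

lemma dy_sub (hf : SmoothOn V f) (hg : SmoothOn V g) (h : (x, y) ∈ V) (i : Fin 4) :
    dy i (fun x y => f x y - g x y) x y = dy i f x y - dy i g x y := by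
  unfold dy
  rw [fderiv_fun_sub (hf.differentiableAt_right hV h) (hg.differentiableAt_right hV h)]
  rfl

lemma dx_mul (hf : SmoothOn V f) (hg : SmoothOn V g) (h : (x, y) ∈ V) (i : Fin 4) :
    dx i (fun x y => f x y * g x y) x y = dx i f x y * g x y + f x y * dx i g x y := by
  unfold dx
  rw [fderiv_fun_mul (hf.differentiableAt_left hV h) (hg.differentiableAt_left hV h)]
  simp
  ring

lemma dy_mul (hf : SmoothOn V f) (hg : SmoothOn V g) (h : (x, y) ∈ V) (i : Fin 4) :
    dy i (fun x y => f x y * g x y) x y = dy i f x y * g x y + f x y * dy i g x y := by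
  unfold dy
  rw [fderiv_fun_mul (hf.differentiableAt_right hV h) (hg.differentiableAt_right hV h)]
  simp
  ring

lemma dx_sum {f : Fin 4 → LocalFun} (hf : ∀ k, SmoothOn V (f k)) (h : (x, y) ∈ V) (i : Fin 4) :
    dx i (fun x y => ∑ k, f k x y) x y = ∑ k, dx i (f k) x y := by
  unfold dx
  rw [fderiv_fun_sum fun k _ => (hf k).differentiableAt_left hV h]
  simp

lemma dy_sum {f : Fin 4 → LocalFun} (hf : ∀ k, SmoothOn V (f k)) (h : (x, y) ∈ V) (i : Fin 4) :
    dy i (fun x y => ∑ k, f k x y) x y = ∑ k, dy i (f k) x y := by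
  unfold dy
  rw [fderiv_fun_sum fun k _ => (hf k).differentiableAt_right hV h]
  simp

lemma dx_sqrt (hf : SmoothOn V f) (hpos : ∀ {x y}, (x, y) ∈ V → 0 < f x y) (h : (x, y) ∈ V)
    (i : Fin 4) : dx i (fun x y => Real.sqrt (f x y)) x y =
      dx i f x y / (2 * Real.sqrt (f x y)) := by
  unfold dx
  rw [((hf.differentiableAt_left hV h).hasFDerivAt.sqrt (hpos h).ne').fderiv]
  simp
  ring

lemma dy_sqrt (hf : SmoothOn V f) (hpos : ∀ {x y}, (x, y) ∈ V → 0 < f x y) (h : (x, y) ∈ V)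
    (i : Fin 4) : dy i (fun x y => Real.sqrt (f x y)) x y =
      dy i f x y / (2 * Real.sqrt (f x y)) := by
  unfold dy
  rw [((hf.differentiableAt_right hV h).hasFDerivAt.sqrt (hpos h).ne').fderiv]
  simp
  ring

omit hV in
@[simp] lemma dy_base (f : E4 → ℝ) (i : Fin 4) : dy i (fun x _ => f x) x y = 0 := by
  simp [dy]

omit hV in
@[simp] lemma dx_coord (i l : Fin 4) : dx i (fun _ y => y l) x y = 0 := by
  simp [dx]

omit hV in
@[simp] lemma dy_coord (i l : Fin 4) :
    dy i (fun _ y => y l) x y = if l = i then 1 else 0 := by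
  have : HasFDerivAt (fun y : E4 => y l) (EuclideanSpace.proj (𝕜 := ℝ) l) y :=
    (EuclideanSpace.proj (𝕜 := ℝ) l).hasFDerivAt
  simp [dy, this.fderiv]

omit hV in
lemma dx_base (f : E4 → ℝ) (i : Fin 4) : dx i (fun x _ => f x) x y = partialDeriv i f x := rfl

end Calculus

/-! ### Matrices, quadratic forms and linear forms -/

lemma contDiffOn_matrix_det {E : Type*} [NormedAddCommGroup E] [NormedSpace ℝ E] {s : Set E}
    {B : E → Matrix (Fin 4) (Fin 4) ℝ} (hB : ∀ i j, ContDiffOn ℝ ∞ (fun x => B x i j) s) :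
    ContDiffOn ℝ ∞ (fun x => (B x).det) s := by
  simp only [Matrix.det_apply]
  refine ContDiffOn.sum fun σ _ => ?_
  exact ContDiffOn.const_smul _ (contDiffOn_prod fun i _ => hB _ _)

/-- Cramer's rule: an entry of the inverse is a quotient of determinants, hence smooth where the
denominator does not vanish. -/
lemma contDiffOn_matrix_inv {E : Type*} [NormedAddCommGroup E] [NormedSpace ℝ E] {s : Set E}
    {B : E → Matrix (Fin 4) (Fin 4) ℝ} (hB : ∀ i j, ContDiffOn ℝ ∞ (fun x => B x i j) s)
    (hdet : ∀ x ∈ s, (B x).det ≠ 0) (i j : Fin 4) :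
    ContDiffOn ℝ ∞ (fun x => (B x)⁻¹ i j) s := by
  have h1 : ContDiffOn ℝ ∞ (fun x => ((B x).updateRow j (Pi.single i 1)).det) s := by
    refine contDiffOn_matrix_det fun k l => ?_
    by_cases hk : k = j
    · subst hk
      simpa using contDiffOn_const
    · simpa [Matrix.updateRow_ne hk] using hB k l
  refine (((contDiffOn_matrix_det hB).inv hdet).mul h1).congr fun x _ => ?_
  simp [Matrix.inv_def, Matrix.adjugate_apply]

lemma IsLorentzianMatrix.det_ne_zero {B : Matrix (Fin 4) (Fin 4) ℝ} (h : IsLorentzianMatrix B) :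
    B.det ≠ 0 := by
  obtain ⟨P, hP, h | h⟩ := h <;>
  · intro h0
    have := congrArg Matrix.det h
    simp [Matrix.det_mul, h0, Fin.prod_univ_four] at this

/-- The covector `a_ij y^j`. -/
def lower (a : Matrix (Fin 4) (Fin 4) ℝ) (y : E4) (i : Fin 4) : ℝ := ∑ j, a i j * y j

lemma sum_mul_lower (a : Matrix (Fin 4) (Fin 4) ℝ) (y : E4) : ∑ i, y i * lower a y i = quad a y := by
  simp only [lower, quad, Finset.mul_sum]
  exact Finset.sum_congr rfl fun i _ => Finset.sum_congr rfl fun j _ => by ring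

lemma dy_const_lower (a : Matrix (Fin 4) (Fin 4) ℝ) (x y : E4) (i k : Fin 4) :
    dy k (fun _ y => lower a y i) x y = a i k := by
  unfold lower
  rw [dy_sum isOpen_univ (fun _ => (SmoothOn.const _).mul (.coord _)) (Set.mem_univ (x, y))]
  have : ∀ j, dy k (fun _ y => a i j * y j) x y = if j = k then a i j else 0 := fun j => by
    rw [dy_mul isOpen_univ (.const _) (.coord j) (Set.mem_univ (x, y)), dy_coord,
      dy_base (fun _ => a i j)]
    simp
  simp [this]

lemma dy_const_lin (b : Fin 4 → ℝ) (x y : E4) (k : Fin 4) :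
    dy k (fun _ y => lin b y) x y = b k :=
  -- A linear form is one row of the matrix all of whose rows are `b`; the row index `0` is
  -- arbitrary.
  dy_const_lower (Matrix.of fun _ => b) x y 0 k

lemma dy_const_quad {a : Matrix (Fin 4) (Fin 4) ℝ} (ha : ∀ i j, a i j = a j i) (x y : E4)
    (k : Fin 4) : dy k (fun _ y => quad a y) x y = 2 * lower a y k := by
  have hs : ∀ i, SmoothOn Set.univ (fun _ y => lower a y i) := fun i =>
    .sum fun _ _ => (SmoothOn.const _).mul (.coord _)
  simp only [← sum_mul_lower]
  rw [dy_sum isOpen_univ (fun i => (SmoothOn.coord i).mul (hs i)) (Set.mem_univ (x, y))]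
  simp only [dy_mul isOpen_univ (.coord _) (hs _) (Set.mem_univ (x, y)), dy_const_lower, dy_coord,
    ite_mul, one_mul, zero_mul, Finset.sum_add_distrib, Finset.sum_ite_eq', Finset.mem_univ,
    if_true, two_mul]
  congr 1
  exact Finset.sum_congr rfl fun i _ => by rw [ha i k, mul_comm]

/-! ### Derivatives of `F = α + β` and the fundamental tensor -/

namespace IsRandersChart

variable {U : Set E4} {V : Set (E4 × E4)} {a : E4 → Matrix (Fin 4) (Fin 4) ℝ}
  {b : E4 → Fin 4 → ℝ} {F : LocalFun} (hR : IsRandersChart U V a b F) {x y : E4}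

include hR

lemma smooth_metric (i j : Fin 4) : SmoothOn V (fun x _ => a x i j) :=
  SmoothOn.base (hR.metric_smooth i j) hR.mem_base

lemma smooth_form (i : Fin 4) : SmoothOn V (fun x _ => b x i) :=
  SmoothOn.base (hR.form_smooth i) hR.mem_base

lemma smooth_quad : SmoothOn V (fun x y => quad (a x) y) :=
  .sum fun _ _ => .sum fun _ _ => (hR.smooth_metric _ _).mul ((SmoothOn.coord _).mul (.coord _))

lemma smooth_lin : SmoothOn V (fun x y => lin (b x) y) :=
  .sum fun _ _ => (hR.smooth_form _).mul (.coord _)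

lemma smooth_sqrt : SmoothOn V (fun x y => Real.sqrt (quad (a x) y)) :=
  hR.smooth_quad.sqrt hR.quad_pos

lemma smooth : SmoothOn V F := (hR.smooth_sqrt.add hR.smooth_lin).congr hR.eq_randers

lemma dx_lin (h : (x, y) ∈ V) (k : Fin 4) :
    dx k (fun x y => lin (b x) y) x y = ∑ i, partialDeriv k (fun x => b x i) x * y i := by
  unfold lin
  rw [dx_sum hR.isOpen_domain (fun _ => (hR.smooth_form _).mul (.coord _)) h]
  simp [dx_mul hR.isOpen_domain (hR.smooth_form _) (.coord _) h, dx_base]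

lemma dy_quad (h : (x, y) ∈ V) (k : Fin 4) :
    dy k (fun x y => quad (a x) y) x y = 2 * lower (a x) y k :=
  dy_const_quad (hR.metric_symm x (hR.mem_base h)) x y k

lemma dx_quad (h : (x, y) ∈ V) (k : Fin 4) :
    dx k (fun x y => quad (a x) y) x y =
      ∑ i, ∑ j, partialDeriv k (fun x => a x i j) x * (y i * y j) := by
  have hs : ∀ i j, SmoothOn V (fun x y => a x i j * (y i * y j)) := fun i j =>
    (hR.smooth_metric i j).mul ((SmoothOn.coord _).mul (.coord _))
  unfold quad
  rw [dx_sum hR.isOpen_domain (fun _ => .sum fun _ _ => hs _ _) h]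
  refine Finset.sum_congr rfl fun i _ => ?_
  rw [dx_sum hR.isOpen_domain (fun _ => hs _ _) h]
  refine Finset.sum_congr rfl fun j _ => ?_
  rw [dx_mul hR.isOpen_domain (hR.smooth_metric i j) ((SmoothOn.coord _).mul (.coord _)) h,
    dx_mul hR.isOpen_domain (.coord _) (.coord _) h]
  simp [dx_base]

lemma dy_eq (h : (x, y) ∈ V) (k : Fin 4) :
    dy k F x y = lower (a x) y k / Real.sqrt (quad (a x) y) + b x k := by
  rw [dy_congr hR.isOpen_domain hR.eq_randers h,
    dy_add hR.isOpen_domain hR.smooth_sqrt hR.smooth_lin h,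
    dy_sqrt hR.isOpen_domain hR.smooth_quad hR.quad_pos h, hR.dy_quad h,
    show dy k (fun x y => lin (b x) y) x y = b x k from dy_const_lin (b x) x y k,
    mul_div_mul_left _ _ two_ne_zero]

lemma dx_eq (h : (x, y) ∈ V) (k : Fin 4) :
    dx k F x y = (∑ i, ∑ j, partialDeriv k (fun x => a x i j) x * (y i * y j)) /
      (2 * Real.sqrt (quad (a x) y)) + ∑ i, partialDeriv k (fun x => b x i) x * y i := by
  rw [dx_congr hR.isOpen_domain hR.eq_randers h,
    dx_add hR.isOpen_domain hR.smooth_sqrt hR.smooth_lin h,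
    dx_sqrt hR.isOpen_domain hR.smooth_quad hR.quad_pos h, hR.dx_quad h, hR.dx_lin h]

lemma sqrt_pos (h : (x, y) ∈ V) : 0 < Real.sqrt (quad (a x) y) := Real.sqrt_pos.2 (hR.quad_pos h)

lemma euler (h : (x, y) ∈ V) : ∑ k, y k * dy k F x y = F x y := by
  have h0 := hR.sqrt_pos h
  have e : ∀ k, y k * dy k F x y =
      (y k * lower (a x) y k) / Real.sqrt (quad (a x) y) + b x k * y k := fun k => by
    rw [hR.dy_eq h]
    ring
  rw [Finset.sum_congr rfl fun k _ => e k, Finset.sum_add_distrib, ← Finset.sum_div, sum_mul_lower,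
    hR.eq_randers h, lin, Real.div_sqrt]

lemma dy_dy_eq (h : (x, y) ∈ V) (i j : Fin 4) :
    dy i (dy j F) x y = a x j i / Real.sqrt (quad (a x) y) -
      lower (a x) y i * lower (a x) y j / Real.sqrt (quad (a x) y) ^ 3 := by
  have h0 := hR.sqrt_pos h
  have e : ∀ {x y}, (x, y) ∈ V →
      lower (a x) y j = Real.sqrt (quad (a x) y) * (dy j F x y - b x j) := fun {x y} h => by
    rw [hR.dy_eq h]
    field_simp [(hR.sqrt_pos h).ne']
    ring
  have hj := hR.smooth.dy hR.isOpen_domain j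
  have h1 := dy_congr hR.isOpen_domain e h i
  rw [show dy i (fun x y => lower (a x) y j) x y = a x j i from dy_const_lower (a x) x y j i,
    dy_mul hR.isOpen_domain hR.smooth_sqrt (hj.sub (hR.smooth_form _)) h,
    dy_sub hR.isOpen_domain hj (hR.smooth_form _) h, dy_base,
    dy_sqrt hR.isOpen_domain hR.smooth_quad hR.quad_pos h, hR.dy_quad h, hR.dy_eq h] at h1
  rw [h1]
  field_simp
  ring

/-! ### The square of the Finsler function -/

lemma smooth_sq : SmoothOn V (fun x y => F x y ^ 2) := hR.smooth.pow 2

lemma dy_sq (h : (x, y) ∈ V) (i : Fin 4) :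
    dy i (fun x y => F x y ^ 2) x y = 2 * (F x y * dy i F x y) := by
  simp only [pow_two]
  rw [dy_mul hR.isOpen_domain hR.smooth hR.smooth h]
  ring

lemma dx_sq (h : (x, y) ∈ V) (i : Fin 4) :
    dx i (fun x y => F x y ^ 2) x y = 2 * (F x y * dx i F x y) := by
  simp only [pow_two]
  rw [dx_mul hR.isOpen_domain hR.smooth hR.smooth h]
  ring

lemma fundamentalTensor_eq_dy_dy (h : (x, y) ∈ V) (i j : Fin 4) :
    fundamentalTensor F x y i j = (1 / 2) * dy i (dy j (fun x y => F x y ^ 2)) x y := by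
  have e : ∀ {x y}, (x, y) ∈ V → dy j (fun x y => (1 / 2) * F x y ^ 2) x y =
      (1 / 2) * dy j (fun x y => F x y ^ 2) x y := fun {x y} h => by
    rw [dy_mul hR.isOpen_domain (.const _) hR.smooth_sq h]
    simp [dy]
  simp only [fundamentalTensor, Matrix.of_apply]
  rw [dy_congr hR.isOpen_domain e h,
    dy_mul hR.isOpen_domain (.const _) (hR.smooth_sq.dy hR.isOpen_domain j) h]
  simp [dy]

lemma fundamentalTensor_eq (h : (x, y) ∈ V) (i j : Fin 4) :
    fundamentalTensor F x y i j = dy i F x y * dy j F x y + F x y * dy i (dy j F) x y := by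
  rw [hR.fundamentalTensor_eq_dy_dy h, dy_congr hR.isOpen_domain (hR.dy_sq · j) h,
    dy_mul hR.isOpen_domain (.const _) (hR.smooth.mul (hR.smooth.dy hR.isOpen_domain j)) h,
    dy_mul hR.isOpen_domain hR.smooth (hR.smooth.dy hR.isOpen_domain j) h]
  simp [dy]

lemma fundamentalTensor_symm (h : (x, y) ∈ V) (i j : Fin 4) :
    fundamentalTensor F x y i j = fundamentalTensor F x y j i := by
  rw [hR.fundamentalTensor_eq_dy_dy h, hR.fundamentalTensor_eq_dy_dy h,
    hR.smooth_sq.dy_dy hR.isOpen_domain h]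

lemma smooth_fundamentalTensor (i j : Fin 4) :
    SmoothOn V (fun x y => fundamentalTensor F x y i j) := by
  refine SmoothOn.dy hR.isOpen_domain (SmoothOn.dy hR.isOpen_domain ?_ j) i
  exact (SmoothOn.const _).mul hR.smooth_sq

lemma det_fundamentalTensor_ne_zero (h : (x, y) ∈ V) : (fundamentalTensor F x y).det ≠ 0 :=
  (hR.lorentzian h).det_ne_zero

/-- At a zero of `F` the fundamental tensor reduces to `∂̄ᵢF ∂̄ⱼF`, of rank at most one, which
contradicts the Lorentzian signature. This makes division by `F` legitimate although only `F ≥ 0` is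
assumed. -/
lemma ne_zero (h : (x, y) ∈ V) : F x y ≠ 0 := by
  intro h0
  apply hR.det_fundamentalTensor_ne_zero h
  have : fundamentalTensor F x y = Matrix.vecMulVec (fun i => dy i F x y) (fun i => dy i F x y) := by
    ext i j
    rw [hR.fundamentalTensor_eq h, h0]
    simp [Matrix.vecMulVec_apply]
  rw [this, Matrix.det_vecMulVec]

end IsRandersChart

/-- The covector `y^l ∂_l ∂̄_k F² - ∂_k F²`. -/
def sprayCovector (F : LocalFun) (k : Fin 4) : LocalFun :=
  fun x y => (∑ l, y l * dx l (dy k (fun x y => F x y ^ 2)) x y) - dx k (fun x y => F x y ^ 2) x y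

/-- The spray coefficients `g^{ik} (y^l ∂_l ∂̄_k F² - ∂_k F²)`. -/
def spray (F : LocalFun) (i : Fin 4) : LocalFun :=
  fun x y => ∑ k, (fundamentalTensor F x y)⁻¹ i k * sprayCovector F k x y

lemma cartanConnection_eq (F : LocalFun) (i j : Fin 4) (x y : E4) :
    cartanConnection F i j x y = (1 / 4) * dy j (spray F i) x y := rfl

/-! ### The spray and the horizontal constancy of `F` -/

namespace IsRandersChart

variable {U : Set E4} {V : Set (E4 × E4)} {a : E4 → Matrix (Fin 4) (Fin 4) ℝ}
  {b : E4 → Fin 4 → ℝ} {F : LocalFun} (hR : IsRandersChart U V a b F) {x y : E4}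

include hR

lemma smooth_sprayCovector (k : Fin 4) : SmoothOn V (sprayCovector F k) :=
  .sub (.sum fun l _ => (SmoothOn.coord l).mul
    ((hR.smooth_sq.dy hR.isOpen_domain k).dx hR.isOpen_domain l))
    (hR.smooth_sq.dx hR.isOpen_domain k)

lemma smooth_spray (i : Fin 4) : SmoothOn V (spray F i) :=
  .sum fun k _ => SmoothOn.mul (contDiffOn_matrix_inv hR.smooth_fundamentalTensor
    (fun _ hp => hR.det_fundamentalTensor_ne_zero hp) i k) (hR.smooth_sprayCovector k)

lemma fundamentalTensor_mul_spray (h : (x, y) ∈ V) (j : Fin 4) :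
    ∑ i, fundamentalTensor F x y j i * spray F i x y = sprayCovector F j x y := by
  have h1 : (fundamentalTensor F x y).mulVec (fun i => spray F i x y) =
      (fundamentalTensor F x y).mulVec
        ((fundamentalTensor F x y)⁻¹.mulVec (fun k => sprayCovector F k x y)) := rfl
  rw [Matrix.mulVec_mulVec, Matrix.mul_nonsing_inv _
    (hR.det_fundamentalTensor_ne_zero h).isUnit, Matrix.one_mulVec] at h1
  exact congrFun h1 j

lemma euler_sq (h : (x, y) ∈ V) :
    ∑ k, y k * dy k (fun x y => F x y ^ 2) x y = 2 * F x y ^ 2 := by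
  simp only [hR.dy_sq h]
  have h1 : ∀ k, y k * (2 * (F x y * dy k F x y)) = 2 * F x y * (y k * dy k F x y) :=
    fun k => by ring
  simp only [h1, ← Finset.mul_sum, hR.euler h]
  ring

/-- The `y`-derivative of Euler's identity for `F²`, i.e. `∂̄ⱼF²` is homogeneous of degree one. -/
lemma euler_sq_dy (h : (x, y) ∈ V) (j : Fin 4) :
    ∑ k, y k * dy j (dy k (fun x y => F x y ^ 2)) x y = dy j (fun x y => F x y ^ 2) x y := by
  have hs := fun k => hR.smooth_sq.dy hR.isOpen_domain k
  have h1 := dy_congr hR.isOpen_domain hR.euler_sq h j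
  rw [dy_sum hR.isOpen_domain (fun k => (SmoothOn.coord k).mul (hs k)) h,
    dy_mul hR.isOpen_domain (.const 2) hR.smooth_sq h] at h1
  simp only [dy_mul hR.isOpen_domain (.coord _) (hs _) h, dy_coord,
    ite_mul, one_mul, zero_mul, Finset.sum_add_distrib, Finset.sum_ite_eq', Finset.mem_univ,
    if_true, dy_base (fun _ => (2 : ℝ)), zero_add] at h1
  linarith

lemma euler_sq_dx (h : (x, y) ∈ V) (j : Fin 4) :
    ∑ k, y k * dx j (dy k (fun x y => F x y ^ 2)) x y = 2 * dx j (fun x y => F x y ^ 2) x y := by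
  have hs := fun k => hR.smooth_sq.dy hR.isOpen_domain k
  have h1 := dx_congr hR.isOpen_domain hR.euler_sq h j
  rw [dx_sum hR.isOpen_domain (fun k => (SmoothOn.coord k).mul (hs k)) h,
    dx_mul hR.isOpen_domain (.const 2) hR.smooth_sq h] at h1
  simpa [dx_mul hR.isOpen_domain (.coord _) (hs _) h, dx_base (fun _ => (2 : ℝ)), partialDeriv]
    using h1

/-- Contract `g_ki sprayⁱ = sprayCovector_k` with `yᵏ`. By Euler, `yᵏ g_ki` is half of `∂̄ᵢF²`, and
the second-derivative term of the covector gives `2 yˡ∂ₗF²`, of which one copy is subtracted. -/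
lemma sum_dy_mul_spray (h : (x, y) ∈ V) :
    ∑ i, dy i (fun x y => F x y ^ 2) x y * spray F i x y =
      2 * ∑ k, y k * dx k (fun x y => F x y ^ 2) x y := by
  have h1 : ∀ i, dy i (fun x y => F x y ^ 2) x y =
      2 * ∑ k, y k * fundamentalTensor F x y k i := fun i => by
    rw [← hR.euler_sq_dy h, Finset.mul_sum]
    refine Finset.sum_congr rfl fun k _ => ?_
    rw [hR.fundamentalTensor_symm h, hR.fundamentalTensor_eq_dy_dy h]
    ring
  have h2 : ∑ i, dy i (fun x y => F x y ^ 2) x y * spray F i x y =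
      2 * ∑ k, y k * sprayCovector F k x y := by
    simp only [h1, ← hR.fundamentalTensor_mul_spray h, Finset.mul_sum, Finset.sum_mul]
    rw [Finset.sum_comm]
    exact Finset.sum_congr rfl fun i _ => Finset.sum_congr rfl fun j _ => by ring
  rw [h2]
  congr 1
  simp only [sprayCovector, mul_sub, Finset.sum_sub_distrib, Finset.mul_sum]
  rw [Finset.sum_comm]
  have h3 : ∀ l, ∑ k, y k * (y l * dx l (dy k (fun x y => F x y ^ 2)) x y) =
      2 * (y l * dx l (fun x y => F x y ^ 2) x y) := fun l => by
    rw [mul_left_comm, ← hR.euler_sq_dx h, Finset.mul_sum]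
    exact Finset.sum_congr rfl fun k _ => by ring
  rw [Finset.sum_congr rfl fun l _ => h3 l, ← Finset.mul_sum]
  ring

/-- The Finsler function is horizontally constant. -/
lemma sum_cartanConnection_mul_dy (h : (x, y) ∈ V) (j : Fin 4) :
    ∑ i, cartanConnection F i j x y * dy i F x y = dx j F x y := by
  have hs := fun k => hR.smooth_sq.dy hR.isOpen_domain k
  have hs' := fun k => hR.smooth_sq.dx hR.isOpen_domain k
  -- Differentiating the contraction by `yʲ` produces `2 sprayCovector_j` on both sides; what
  -- remains is `8F Nⁱⱼ∂̄ᵢF = 4 ∂ⱼF² = 8F ∂ⱼF`, and `F` is cancelled.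
  have h1 := dy_congr hR.isOpen_domain hR.sum_dy_mul_spray h j
  rw [dy_sum hR.isOpen_domain (fun k => (hs k).mul (hR.smooth_spray k)) h,
    dy_mul hR.isOpen_domain (.const 2) (.sum fun k _ => (SmoothOn.coord k).mul (hs' k)) h,
    dy_sum hR.isOpen_domain (fun k => (SmoothOn.coord k).mul (hs' k)) h] at h1
  simp only [dy_mul hR.isOpen_domain (.coord _) (hs' _) h,
    dy_mul hR.isOpen_domain (hs _) (hR.smooth_spray _) h, dy_coord,
    ite_mul, one_mul, zero_mul, Finset.sum_add_distrib, Finset.sum_ite_eq', Finset.mem_univ,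
    if_true, dy_base (fun _ => (2 : ℝ)), zero_add] at h1
  have h2 : ∑ i, dy j (dy i (fun x y => F x y ^ 2)) x y * spray F i x y =
      2 * sprayCovector F j x y := by
    rw [← hR.fundamentalTensor_mul_spray h, Finset.mul_sum]
    exact Finset.sum_congr rfl fun i _ => by
      rw [hR.fundamentalTensor_eq_dy_dy h]
      ring
  have h3 : ∑ k, y k * dy j (dx k (fun x y => F x y ^ 2)) x y =
      sprayCovector F j x y + dx j (fun x y => F x y ^ 2) x y := by
    simp only [sprayCovector, sub_add_cancel]
    exact Finset.sum_congr rfl fun k _ => by rw [hR.smooth_sq.dy_dx hR.isOpen_domain h]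
  have h4 : ∑ i, dy i (fun x y => F x y ^ 2) x y * dy j (spray F i) x y =
      8 * (F x y * ∑ i, cartanConnection F i j x y * dy i F x y) := by
    rw [Finset.mul_sum, Finset.mul_sum]
    exact Finset.sum_congr rfl fun i _ => by
      rw [hR.dy_sq h, cartanConnection_eq]
      ring
  rw [h2, h3, h4, hR.dx_sq h] at h1
  apply mul_left_cancel₀ (hR.ne_zero h)
  linarith

end IsRandersChart

/-! ### Independence of `α` from analytic functions of `y` -/

lemma analyticAt_coord (i : Fin 4) (y : E4) : AnalyticAt ℝ (fun y : E4 => y i) y :=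
  (EuclideanSpace.proj (𝕜 := ℝ) i).analyticAt y

lemma analyticAt_quad (a : Matrix (Fin 4) (Fin 4) ℝ) (y : E4) : AnalyticAt ℝ (quad a) y :=
  Finset.analyticAt_fun_sum _ fun i _ => Finset.analyticAt_fun_sum _ fun j _ =>
    analyticAt_const.mul ((analyticAt_coord i y).mul (analyticAt_coord j y))

lemma analyticAt_lin (b : Fin 4 → ℝ) (y : E4) : AnalyticAt ℝ (lin b) y :=
  Finset.analyticAt_fun_sum _ fun i _ => analyticAt_const.mul (analyticAt_coord i y)

lemma eq_zero_of_analytic {f : E4 → ℝ} (hf : ∀ y, AnalyticAt ℝ f y) {O : Set E4} (hO : IsOpen O)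
    (hne : O.Nonempty) (h : ∀ y ∈ O, f y = 0) (y : E4) : f y = 0 := by
  obtain ⟨y₀, h₀⟩ := hne
  have h1 : AnalyticOnNhd ℝ f Set.univ := fun y _ => hf y
  have h2 : AnalyticOnNhd ℝ (fun _ : E4 => (0 : ℝ)) Set.univ := fun y _ => analyticAt_const
  exact congrFun (h1.eq_of_eventuallyEq h2
    (Filter.eventuallyEq_of_mem (hO.mem_nhds h₀) h)) y

/-- The square root of an indefinite analytic function is independent of the analytic functions. -/
lemma eq_zero_of_add_sqrt_mul {A f g : E4 → ℝ} (hA : ∀ y, AnalyticAt ℝ A y)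
    (hf : ∀ y, AnalyticAt ℝ f y) (hg : ∀ y, AnalyticAt ℝ g y) {O : Set E4} (hO : IsOpen O)
    (hne : O.Nonempty) (hpos : ∀ y ∈ O, 0 < A y)
    (h : ∀ y ∈ O, f y + Real.sqrt (A y) * g y = 0) (hneg : ∃ y, A y < 0) :
    (∀ y, f y = 0) ∧ ∀ y, g y = 0 := by
  -- Squaring `f = -√A g` removes the root; the resulting identity is analytic, so it spreads from
  -- `O` to the whole space.
  have h1 : ∀ y, f y ^ 2 - A y * g y ^ 2 = 0 := by
    refine eq_zero_of_analytic (fun y => ((hf y).pow 2).sub ((hA y).mul ((hg y).pow 2))) hO hne ?_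
    intro y hy
    have e : f y = -(Real.sqrt (A y) * g y) := by linarith [h y hy]
    rw [e, neg_sq, mul_pow, Real.sq_sqrt (hpos y hy).le, sub_self]
  have hcont : Continuous A := continuous_iff_continuousAt.2 fun y => (hA y).continuousAt
  have hO' : IsOpen {y | A y < 0} := isOpen_lt hcont continuous_const
  -- Where `A < 0`, the relation is a vanishing sum of the non-negative terms `f²` and `-A g²`. This
  -- region is open, so `f` and `g` vanish everywhere by analyticity.
  have h2 : ∀ y, A y < 0 → f y = 0 ∧ g y = 0 := fun y hy => by
    have h3 := h1 y
    have h4 : 0 ≤ -A y * g y ^ 2 := mul_nonneg (by linarith) (sq_nonneg _)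
    have h5 : f y ^ 2 = 0 := by nlinarith [sq_nonneg (f y)]
    have h6 : A y * g y ^ 2 = 0 := by linarith
    exact ⟨by simpa using h5, by simpa [hy.ne] using h6⟩
  exact ⟨eq_zero_of_analytic hf hO' hneg fun y hy => (h2 y hy).1,
    eq_zero_of_analytic hg hO' hneg fun y hy => (h2 y hy).2⟩

lemma IsLorentzianMatrix.exists_quad_neg {a : Matrix (Fin 4) (Fin 4) ℝ}
    (h : IsLorentzianMatrix a) : ∃ y, quad a y < 0 := by
  have key : ∀ (P : Matrix (Fin 4) (Fin 4) ℝ) (k : Fin 4),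
      quad a (WithLp.toLp 2 (fun i => P i k)) = (P.transpose * a * P) k k := fun P k => by
    simp only [quad, Matrix.mul_apply, Matrix.transpose_apply, Finset.sum_mul]
    rw [Finset.sum_comm]
    exact Finset.sum_congr rfl fun i _ => Finset.sum_congr rfl fun j _ => by ring
  obtain ⟨P, -, h | h⟩ := h
  -- The form takes its diagonal values on the columns of `P`; a `-1` sits at index `1` in one sign
  -- convention and at index `0` in the other.
  · exact ⟨_, by rw [key P 1, h]; simp⟩
  · exact ⟨_, by rw [key P 0, h]; simp⟩

lemma lin_single (b : Fin 4 → ℝ) (i : Fin 4) : lin b (EuclideanSpace.single i 1) = b i := by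
  simp [lin]

/-- Polarization, tested on basis vectors and on sums of two of them. -/
lemma eq_zero_of_quad {a : Matrix (Fin 4) (Fin 4) ℝ} (hs : ∀ i j, a i j = a j i)
    (h : ∀ y, quad a y = 0) (i j : Fin 4) : a i j = 0 := by
  have h1 : ∀ i, a i i = 0 := fun i => by
    simpa [quad, Pi.single_apply] using h (EuclideanSpace.single i 1)
  have h2 := h (EuclideanSpace.single i 1 + EuclideanSpace.single j 1)
  simp [quad, mul_add, Finset.sum_add_distrib, h1, hs j i] at h2
  linarith

/-! ### The Berwald connection is Levi-Civita and `b` is parallel -/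

namespace IsRandersChart

variable {U : Set E4} {V : Set (E4 × E4)} {a : E4 → Matrix (Fin 4) (Fin 4) ℝ}
  {b : E4 → Fin 4 → ℝ} {F : LocalFun} (hR : IsRandersChart U V a b F) {x y : E4}

include hR

lemma isOpen_fiber (x : E4) : IsOpen {y | (x, y) ∈ V} :=
  hR.isOpen_domain.preimage (Continuous.prodMk_right x)

lemma eq_zero_of_add_sqrt_mul (hx : x ∈ U) {f g : E4 → ℝ} (hf : ∀ y, AnalyticAt ℝ f y)
    (hg : ∀ y, AnalyticAt ℝ g y)
    (h : ∀ y, (x, y) ∈ V → f y + Real.sqrt (quad (a x) y) * g y = 0) :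
    (∀ y, f y = 0) ∧ ∀ y, g y = 0 :=
  FinslerGravity.eq_zero_of_add_sqrt_mul (analyticAt_quad (a x)) hf hg (hR.isOpen_fiber x)
    (hR.nonempty_fiber x hx) (fun _ hy => hR.quad_pos hy) h
    (hR.metric_lorentzian x hx).exists_quad_neg

lemma det_metric_ne_zero (hx : x ∈ U) : (a x).det ≠ 0 := (hR.metric_lorentzian x hx).det_ne_zero

variable {Γ : Fin 4 → Fin 4 → Fin 4 → E4 → ℝ}
  (hN : ∀ {x y}, (x, y) ∈ V → ∀ i j, cartanConnection F i j x y = ∑ k, Γ i j k x * y k)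

include hN

/-- `Γⁱⱼₖ` is a quarter of the second `y`-derivative of the spray, which is symmetric. As `Γ` does
not depend on `y`, one direction of the fibre suffices. -/
lemma connection_symm (hx : x ∈ U) (i j k : Fin 4) : Γ i j k x = Γ i k j x := by
  obtain ⟨y, h⟩ := hR.nonempty_fiber x hx
  have key : ∀ j k, Γ i j k x = (1 / 4) * dy k (dy j (spray F i)) x y := fun j k => by
    have h1 : dy k (cartanConnection F i j) x y = Γ i j k x := by
      have : dy k (cartanConnection F i j) x y = dy k (fun _ y => lin (fun k => Γ i j k x) y) x y := by
        unfold dy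
        rw [Filter.EventuallyEq.fderiv_eq
          ((eventually_right hR.isOpen_domain h).mono fun _ h => hN h i j)]
        rfl
      rw [this, dy_const_lin]
    rw [← h1, dy_congr hR.isOpen_domain (fun _ => cartanConnection_eq F i j _ _) h,
      dy_mul hR.isOpen_domain (.const _) ((hR.smooth_spray i).dy hR.isOpen_domain j) h,
      dy_base (fun _ => (1 / 4 : ℝ))]
    simp
  rw [key, key, (hR.smooth_spray i).dy_dy hR.isOpen_domain h]

/-- Let `C` and `B` be the covariant derivatives of `a` and `b` along `∂ⱼ` with respect to `Γ`.
Horizontal constancy of `α + β`, times `2α`, says `C(y, y) + 2α B(y) = 0`, and independence of `α`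
kills both terms. -/
lemma parallel_aux (hx : x ∈ U) (j : Fin 4) :
    (∀ m n, partialDeriv j (fun x => a x m n) x =
      ∑ i, (a x i m * Γ i j n x + a x i n * Γ i j m x)) ∧
    ∀ m, partialDeriv j (fun x => b x m) x = ∑ i, Γ i j m x * b x i := by
  set C : Matrix (Fin 4) (Fin 4) ℝ := Matrix.of fun m n => partialDeriv j (fun x => a x m n) x -
      ∑ i, (a x i m * Γ i j n x + a x i n * Γ i j m x) with hC
  set B : Fin 4 → ℝ := fun m => partialDeriv j (fun x => b x m) x - ∑ i, Γ i j m x * b x i with hB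
  have hCs : ∀ m n, C m n = C n m := fun m n => by
    simp only [hC, Matrix.of_apply]
    congr 1
    · unfold partialDeriv
      rw [Filter.EventuallyEq.fderiv_eq (Filter.eventuallyEq_of_mem
        (hR.isOpen_base.mem_nhds hx) fun x hx => hR.metric_symm x hx m n)]
    · exact Finset.sum_congr rfl fun i _ => add_comm _ _
  have key := hR.eq_zero_of_add_sqrt_mul hx (f := quad C) (g := fun y => 2 * lin B y)
    (analyticAt_quad C) (fun y => analyticAt_const.mul (analyticAt_lin B y))
    fun y h => by
      have h0 := hR.sqrt_pos h
      have h1 := hR.sum_cartanConnection_mul_dy h j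
      rw [hR.dx_eq h] at h1
      simp only [hR.dy_eq h, hN h] at h1
      set α := Real.sqrt (quad (a x) y) with hα
      have e1 : quad C y = (∑ m, ∑ n, partialDeriv j (fun x => a x m n) x * (y m * y n)) -
          2 * ∑ i, (∑ k, Γ i j k x * y k) * lower (a x) y i := by
        have e : ∑ i, (∑ k, Γ i j k x * y k) * lower (a x) y i =
            ∑ m, ∑ n, (∑ i, a x i m * Γ i j n x) * (y m * y n) := by
          simp only [lower, Finset.sum_mul_sum]
          rw [Finset.sum_comm, Finset.sum_comm (γ := Fin 4) (s := Finset.univ) (t := Finset.univ)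
            (f := fun m n => (∑ i, a x i m * Γ i j n x) * (y m * y n))]
          refine Finset.sum_congr rfl fun n _ => ?_
          rw [Finset.sum_comm]
          refine Finset.sum_congr rfl fun m _ => ?_
          rw [Finset.sum_mul]
          exact Finset.sum_congr rfl fun i _ => by ring
        have e' : ∑ m, ∑ n, (∑ i, a x i m * Γ i j n x) * (y m * y n) =
            ∑ m, ∑ n, (∑ i, a x i n * Γ i j m x) * (y m * y n) := by
          rw [Finset.sum_comm]
          exact Finset.sum_congr rfl fun m _ => Finset.sum_congr rfl fun n _ => by ring
        -- The factor two is split so that one copy, with `m` and `n` exchanged, matches the second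
        -- of the two connection terms in `C`.
        rw [two_mul, e]
        nth_rewrite 2 [e']
        simp only [quad, hC, Matrix.of_apply, Finset.sum_add_distrib, sub_mul, add_mul,
          Finset.sum_sub_distrib]
      have e2 : lin B y = (∑ m, partialDeriv j (fun x => b x m) x * y m) -
          ∑ i, (∑ k, Γ i j k x * y k) * b x i := by
        simp only [lin, hB, sub_mul, Finset.sum_sub_distrib, Finset.sum_mul]
        congr 1
        rw [Finset.sum_comm]
        exact Finset.sum_congr rfl fun m _ => Finset.sum_congr rfl fun n _ => by ring
      have e3 : ∑ i, (∑ k, Γ i j k x * y k) * (lower (a x) y i / α + b x i) =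
          (∑ i, (∑ k, Γ i j k x * y k) * lower (a x) y i) / α +
            ∑ i, (∑ k, Γ i j k x * y k) * b x i := by
        rw [Finset.sum_div, ← Finset.sum_add_distrib]
        exact Finset.sum_congr rfl fun i _ => by ring
      rw [e3] at h1
      rw [e1, e2]
      generalize (∑ m, ∑ n, partialDeriv j (fun x => a x m n) x * (y m * y n)) = D at h1 ⊢
      field_simp at h1
      linear_combination -h1
  refine ⟨fun m n => ?_, fun m => ?_⟩
  · have := eq_zero_of_quad hCs key.1 m n
    simp only [hC, Matrix.of_apply] at this
    linarith
  · have := key.2 (EuclideanSpace.single m 1)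
    simp only [lin_single, hB] at this
    linarith

/-- Uniqueness of the Levi-Civita connection: for a torsion-free metric `Γ` the cyclic combination
of `∂a` collapses to `2 a_lm Γᵐⱼₖ`. -/
lemma christoffel_eq (hx : x ∈ U) (i j k : Fin 4) : christoffel a i j k x = Γ i j k x := by
  have hp := fun j => (hR.parallel_aux hN hx j).1
  have hs := hR.connection_symm hN hx
  have h1 : ∀ l, partialDeriv j (fun x' => a x' l k) x + partialDeriv k (fun x' => a x' l j) x -
      partialDeriv l (fun x' => a x' j k) x = 2 * ∑ m, a x l m * Γ m j k x := fun l => by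
    rw [hp, hp, hp, Finset.mul_sum, ← Finset.sum_add_distrib, ← Finset.sum_sub_distrib]
    refine Finset.sum_congr rfl fun m _ => ?_
    rw [hs m k j, hs m k l, hs m j l, hR.metric_symm x hx l m]
    ring
  have h2 : christoffel a i j k x =
      (a x)⁻¹.mulVec ((a x).mulVec (fun m => Γ m j k x)) i := by
    simp only [christoffel, h1, Matrix.mulVec, dotProduct, Finset.mul_sum]
    exact Finset.sum_congr rfl fun l _ => Finset.sum_congr rfl fun m _ => by ring
  rw [h2, Matrix.mulVec_mulVec, Matrix.nonsing_inv_mul _ (hR.det_metric_ne_zero hx).isUnit,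
    Matrix.one_mulVec]

end IsRandersChart

lemma matrix_inv_symm {a : Matrix (Fin 4) (Fin 4) ℝ} (hs : ∀ i j, a i j = a j i) (i j : Fin 4) :
    a⁻¹ i j = a⁻¹ j i := by
  have h := Matrix.transpose_nonsing_inv a
  rw [show a.transpose = a from Matrix.ext fun i j => hs j i] at h
  exact congrFun (congrFun h j) i

/-! ### Curvature of the metric in a chart -/

section PartialDeriv

variable {U : Set E4} (hU : IsOpen U) {f g : E4 → ℝ} {x : E4}

/-- With a dummy first variable, `partialDeriv` becomes `dy`, so the calculus rules for `(x, y)`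
carry over. -/
lemma smoothOn_univ_prod (hf : ContDiffOn ℝ ∞ f U) : SmoothOn (Set.univ ×ˢ U) (fun _ x => f x) :=
  ContDiffOn.comp hf contDiff_snd.contDiffOn fun _ hp => hp.2

include hU

lemma contDiffOn_partialDeriv (hf : ContDiffOn ℝ ∞ f U) (i : Fin 4) :
    ContDiffOn ℝ ∞ (partialDeriv i f) U :=
  (hf.fderiv_of_isOpen (m := ∞) hU (by simp)).clm_apply contDiffOn_const

lemma partialDeriv_comm (hf : ContDiffOn ℝ ∞ f U) (hx : x ∈ U) (i j : Fin 4) :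
    partialDeriv i (partialDeriv j f) x = partialDeriv j (partialDeriv i f) x :=
  (smoothOn_univ_prod hf).dy_dy (isOpen_univ.prod hU) (x := x) ⟨Set.mem_univ _, hx⟩ i j

lemma partialDeriv_congr (h : ∀ x ∈ U, f x = g x) (hx : x ∈ U) (i : Fin 4) :
    partialDeriv i f x = partialDeriv i g x := by
  unfold partialDeriv
  rw [Filter.EventuallyEq.fderiv_eq (Filter.eventuallyEq_of_mem (hU.mem_nhds hx) h)]

lemma partialDeriv_mul (hf : ContDiffOn ℝ ∞ f U) (hg : ContDiffOn ℝ ∞ g U) (hx : x ∈ U)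
    (i : Fin 4) : partialDeriv i (fun x => f x * g x) x =
      partialDeriv i f x * g x + f x * partialDeriv i g x :=
  dy_mul (isOpen_univ.prod hU) (smoothOn_univ_prod hf) (smoothOn_univ_prod hg)
    (x := x) ⟨Set.mem_univ _, hx⟩ i

lemma partialDeriv_add (hf : ContDiffOn ℝ ∞ f U) (hg : ContDiffOn ℝ ∞ g U) (hx : x ∈ U)
    (i : Fin 4) : partialDeriv i (fun x => f x + g x) x = partialDeriv i f x + partialDeriv i g x :=
  dy_add (isOpen_univ.prod hU) (smoothOn_univ_prod hf) (smoothOn_univ_prod hg)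
    (x := x) ⟨Set.mem_univ _, hx⟩ i

lemma partialDeriv_sum {f : Fin 4 → E4 → ℝ} (hf : ∀ k, ContDiffOn ℝ ∞ (f k) U) (hx : x ∈ U)
    (i : Fin 4) : partialDeriv i (fun x => ∑ k, f k x) x = ∑ k, partialDeriv i (f k) x :=
  dy_sum (isOpen_univ.prod hU) (fun k => smoothOn_univ_prod (hf k))
    (x := x) ⟨Set.mem_univ _, hx⟩ i

end PartialDeriv

/-- A smooth pseudo-Riemannian metric on an open set of coordinates, with its Christoffel symbols
being torsion free and metric. -/
structure IsMetricChart (U : Set E4) (a : E4 → Matrix (Fin 4) (Fin 4) ℝ) : Prop where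
  isOpen : IsOpen U
  smooth : ∀ i j, ContDiffOn ℝ ∞ (fun x => a x i j) U
  symm : ∀ x ∈ U, ∀ i j, a x i j = a x j i
  det_ne_zero : ∀ x ∈ U, (a x).det ≠ 0
  christoffel_symm : ∀ x ∈ U, ∀ i j k, christoffel a i j k x = christoffel a i k j x
  metric_compatible : ∀ x ∈ U, ∀ j m n, partialDeriv j (fun x => a x m n) x =
    ∑ i, (a x i m * christoffel a i j n x + a x i n * christoffel a i j m x)

namespace IsMetricChart

variable {U : Set E4} {a : E4 → Matrix (Fin 4) (Fin 4) ℝ} (hM : IsMetricChart U a) {x : E4}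

include hM

lemma smooth_christoffel (i j k : Fin 4) : ContDiffOn ℝ ∞ (christoffel a i j k) U :=
  contDiffOn_const.mul <| ContDiffOn.sum fun l _ =>
    (contDiffOn_matrix_inv hM.smooth hM.det_ne_zero i l).mul <|
      ((contDiffOn_partialDeriv hM.isOpen (hM.smooth l k) j).add
        (contDiffOn_partialDeriv hM.isOpen (hM.smooth l j) k)).sub
        (contDiffOn_partialDeriv hM.isOpen (hM.smooth j k) l)

/-- A parallel `1`-form annihilates the curvature. -/
lemma sum_mul_riemannCurvature {b : E4 → Fin 4 → ℝ} (hb : ∀ i, ContDiffOn ℝ ∞ (fun x => b x i) U)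
    (hp : ∀ x ∈ U, ∀ j m, partialDeriv j (fun x => b x m) x = ∑ i, christoffel a i j m x * b x i)
    (hx : x ∈ U) (m j k : Fin 4) : ∑ i, b x i * riemannCurvature a m i j k x = 0 := by
  -- Parallelism, used twice, expresses `∂ₖ∂ⱼbₘ` through `b` itself; equality of mixed derivatives
  -- is then the vanishing of `bᵢ R̄ₘⁱⱼₖ`.
  have key : ∀ j k, partialDeriv k (partialDeriv j (fun x => b x m)) x =
      ∑ i, b x i * (partialDeriv k (christoffel a i j m) x +
        ∑ n, christoffel a i n k x * christoffel a n j m x) := fun j k => by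
    rw [partialDeriv_congr hM.isOpen (fun x hx => hp x hx j m) hx,
      partialDeriv_sum hM.isOpen (fun i => (hM.smooth_christoffel i j m).mul (hb i)) hx]
    simp only [partialDeriv_mul hM.isOpen (hM.smooth_christoffel _ _ _) (hb _) hx, hp x hx,
      Finset.sum_add_distrib, mul_add, Finset.mul_sum]
    congr 1
    · exact Finset.sum_congr rfl fun i _ => mul_comm _ _
    · rw [Finset.sum_comm]
      exact Finset.sum_congr rfl fun i _ => Finset.sum_congr rfl fun n _ => by
        rw [hM.christoffel_symm x hx i n k]
        ring
  have h1 := partialDeriv_comm hM.isOpen (hb m) hx j k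
  rw [key, key] at h1
  rw [← sub_eq_zero, ← Finset.sum_sub_distrib] at h1
  rw [← h1]
  refine Finset.sum_congr rfl fun i _ => ?_
  simp only [riemannCurvature, Finset.sum_sub_distrib]
  ring

/-- The Ricci identity for the parallel tensor `a`: metric compatibility, used twice, expresses
`∂ₖ∂ⱼa_mn`, and the part antisymmetric in `j, k` is the sum of the two lowered curvatures. -/
lemma riemannCurvature_lower_antisymm (hx : x ∈ U) (m n j k : Fin 4) :
    ∑ i, a x i m * riemannCurvature a n i j k x = -∑ i, a x i n * riemannCurvature a m i j k x := by
  have hs := hM.christoffel_symm x hx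
  have key : ∀ j k, partialDeriv k (partialDeriv j (fun x => a x m n)) x =
      (∑ i, a x i m * (partialDeriv k (christoffel a i j n) x +
        ∑ p, christoffel a i p k x * christoffel a p j n x)) +
      (∑ i, a x i n * (partialDeriv k (christoffel a i j m) x +
        ∑ p, christoffel a i p k x * christoffel a p j m x)) +
      ((∑ i, ∑ p, a x p i * (christoffel a p k m x * christoffel a i j n x)) +
        ∑ i, ∑ p, a x p i * (christoffel a p k n x * christoffel a i j m x)) := fun j k => by
    have aux : ∀ m n, partialDeriv k (fun x => ∑ i, a x i m * christoffel a i j n x) x =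
        (∑ i, a x i m * (partialDeriv k (christoffel a i j n) x +
          ∑ p, christoffel a i p k x * christoffel a p j n x)) +
        ∑ i, ∑ p, a x p i * (christoffel a p k m x * christoffel a i j n x) := fun m n => by
      rw [partialDeriv_sum hM.isOpen (fun i => (hM.smooth i m).mul (hM.smooth_christoffel i j n)) hx]
      simp only [partialDeriv_mul hM.isOpen (hM.smooth _ _) (hM.smooth_christoffel _ _ _) hx,
        hM.metric_compatible x hx, Finset.sum_add_distrib, mul_add, add_mul, Finset.mul_sum,
        Finset.sum_mul]
      have e : ∑ i, ∑ p, a x p m * christoffel a p k i x * christoffel a i j n x =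
          ∑ i, ∑ p, a x i m * (christoffel a i p k x * christoffel a p j n x) := by
        rw [Finset.sum_comm]
        exact Finset.sum_congr rfl fun i _ => Finset.sum_congr rfl fun p _ => by
          rw [hs i p k]
          ring
      simp only [mul_assoc] at e ⊢
      linarith
    have h2 : ∀ m n, ContDiffOn ℝ ∞ (fun x => ∑ i, a x i m * christoffel a i j n x) U :=
      fun m n => ContDiffOn.sum fun i _ => (hM.smooth i m).mul (hM.smooth_christoffel i j n)
    rw [partialDeriv_congr hM.isOpen (fun x hx => (hM.metric_compatible x hx j m n).trans
      Finset.sum_add_distrib) hx, partialDeriv_add hM.isOpen (h2 m n) (h2 n m) hx, aux, aux]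
    ring
  -- Exchanging `j` and `k` interchanges the two mixed sums, since `a` is symmetric, so they drop
  -- out of the commutator.
  have h0 : ∀ m n j k, ∑ i, ∑ p, a x p i * (christoffel a p k m x * christoffel a i j n x) =
      ∑ i, ∑ p, a x p i * (christoffel a p j n x * christoffel a i k m x) := fun m n j k => by
    rw [Finset.sum_comm]
    exact Finset.sum_congr rfl fun i _ => Finset.sum_congr rfl fun p _ => by
      rw [hM.symm x hx i p]
      ring
  have hR : ∀ m n, ∑ i, a x i m * riemannCurvature a n i j k x =
      (∑ i, a x i m * (partialDeriv j (christoffel a i k n) x +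
        ∑ p, christoffel a i p j x * christoffel a p k n x)) -
      ∑ i, a x i m * (partialDeriv k (christoffel a i j n) x +
        ∑ p, christoffel a i p k x * christoffel a p j n x) := fun m n => by
    rw [← Finset.sum_sub_distrib]
    refine Finset.sum_congr rfl fun i _ => ?_
    simp only [riemannCurvature, Finset.sum_sub_distrib]
    ring
  have h1 := partialDeriv_comm hM.isOpen (hM.smooth m n) hx j k
  rw [key, key, h0 m n j k, h0 n m j k] at h1
  rw [hR, hR]
  linarith

lemma sum_inv_mul_metric (hx : x ∈ U) (i j : Fin 4) :
    ∑ m, (a x)⁻¹ i m * a x m j = if i = j then 1 else 0 := by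
  rw [← Matrix.mul_apply, Matrix.nonsing_inv_mul _ (hM.det_ne_zero x hx).isUnit, Matrix.one_apply]

lemma riemannCurvature_eq (hx : x ∈ U) (n i j k : Fin 4) : riemannCurvature a n i j k x =
    ∑ m, (a x)⁻¹ i m * ∑ p, a x p m * riemannCurvature a n p j k x := by
  simp only [Finset.mul_sum]
  rw [Finset.sum_comm]
  have : ∀ p, ∑ m, (a x)⁻¹ i m * (a x p m * riemannCurvature a n p j k x) =
      if i = p then riemannCurvature a n p j k x else 0 := fun p => by
    simp only [← mul_assoc, ← Finset.sum_mul, hM.symm x hx p, hM.sum_inv_mul_metric hx]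
    simp
  simp [this]

/-- The symmetric inverse metric is contracted with the antisymmetric first pair of the lowered
curvature, so the trace equals its own negative. -/
lemma sum_riemannCurvature_self (hx : x ∈ U) (j k : Fin 4) :
    ∑ i, riemannCurvature a i i j k x = 0 := by
  have h1 : ∑ i, riemannCurvature a i i j k x =
      ∑ i, ∑ m, (a x)⁻¹ i m * ∑ p, a x p m * riemannCurvature a i p j k x :=
    Finset.sum_congr rfl fun i _ => hM.riemannCurvature_eq hx i i j k
  have h2 : ∑ i, ∑ m, (a x)⁻¹ i m * ∑ p, a x p m * riemannCurvature a i p j k x =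
      -∑ i, ∑ m, (a x)⁻¹ i m * ∑ p, a x p m * riemannCurvature a i p j k x := by
    conv_lhs => rw [Finset.sum_comm]
    rw [← Finset.sum_neg_distrib]
    refine Finset.sum_congr rfl fun i _ => ?_
    rw [← Finset.sum_neg_distrib]
    refine Finset.sum_congr rfl fun m _ => ?_
    rw [matrix_inv_symm (hM.symm x hx) m i, hM.riemannCurvature_lower_antisymm hx i m]
    ring
  linarith

lemma ricci_symm (hx : x ∈ U) (l k : Fin 4) : ricci a l k x = ricci a k l x := by
  have hs := hM.christoffel_symm x hx
  have hd : ∀ i j k l, partialDeriv l (christoffel a i j k) x =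
      partialDeriv l (christoffel a i k j) x := fun i j k l =>
    partialDeriv_congr hM.isOpen (fun x hx => hM.christoffel_symm x hx i j k) hx l
  -- The first Bianchi identity, for each `i` before summation; its right-hand side sums to the
  -- vanishing trace.
  have hB : ∀ i, riemannCurvature a l i i k x - riemannCurvature a k i i l x =
      -riemannCurvature a i i k l x := fun i => by
    simp only [riemannCurvature, Finset.sum_sub_distrib]
    rw [hd i k l, hd i i l, hd i k i]
    simp only [hs _ i l, hs _ k l, hs _ i k]
    ring
  have : ricci a l k x - ricci a k l x = 0 := by
    unfold ricci
    rw [← Finset.sum_sub_distrib, Finset.sum_congr rfl fun i _ => hB i, Finset.sum_neg_distrib,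
      hM.sum_riemannCurvature_self hx, neg_zero]
  linarith

/-- The Ricci tensor vanishes on the vector dual to a parallel `1`-form. -/
lemma sum_mul_ricci {b : E4 → Fin 4 → ℝ} (hb : ∀ i, ContDiffOn ℝ ∞ (fun x => b x i) U)
    (hp : ∀ x ∈ U, ∀ j m, partialDeriv j (fun x => b x m) x = ∑ i, christoffel a i j m x * b x i)
    (hx : x ∈ U) (l : Fin 4) : ∑ k, (a x)⁻¹.mulVec (b x) k * ricci a k l x = 0 := by
  -- Antisymmetry of the first pair moves the index `k` onto the metric, so that contraction with
  -- the dual vector of `b` recreates `b_p`, which annihilates the curvature.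
  have h1 : ∀ k, ricci a k l x =
      -∑ i, ∑ m, (a x)⁻¹ i m * ∑ p, a x p k * riemannCurvature a m p i l x := fun k => by
    unfold ricci
    simp only [← Finset.sum_neg_distrib]
    refine Finset.sum_congr rfl fun i _ => ?_
    rw [hM.riemannCurvature_eq hx]
    refine Finset.sum_congr rfl fun m _ => ?_
    rw [hM.riemannCurvature_lower_antisymm hx]
    simp
  have h2 : ∀ p, ∑ k, (a x)⁻¹.mulVec (b x) k * a x p k = b x p := fun p => by
    have : (a x).mulVec ((a x)⁻¹.mulVec (b x)) p = b x p := by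
      rw [Matrix.mulVec_mulVec, Matrix.mul_nonsing_inv _ (hM.det_ne_zero x hx).isUnit,
        Matrix.one_mulVec]
    rw [← this]
    exact Finset.sum_congr rfl fun k _ => mul_comm _ _
  have h3 : ∀ i m, ∑ k, (a x)⁻¹.mulVec (b x) k * ∑ p, a x p k * riemannCurvature a m p i l x = 0 :=
    fun i m => by
      simp only [Finset.mul_sum]
      rw [Finset.sum_comm]
      simp only [← mul_assoc, ← Finset.sum_mul, h2]
      exact hM.sum_mul_riemannCurvature hb hp hx m i l
  have h4 : ∀ k, (a x)⁻¹.mulVec (b x) k * ricci a k l x = -∑ i, ∑ m, (a x)⁻¹ i m *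
      ((a x)⁻¹.mulVec (b x) k * ∑ p, a x p k * riemannCurvature a m p i l x) := fun k => by
    rw [h1, mul_neg, Finset.mul_sum]
    congr 1
    refine Finset.sum_congr rfl fun i _ => ?_
    rw [Finset.mul_sum]
    exact Finset.sum_congr rfl fun m _ => mul_left_comm _ _ _
  rw [Finset.sum_congr rfl fun k _ => h4 k, Finset.sum_neg_distrib, neg_eq_zero, Finset.sum_comm]
  refine Finset.sum_eq_zero fun i _ => ?_
  rw [Finset.sum_comm]
  refine Finset.sum_eq_zero fun m _ => ?_
  rw [← Finset.mul_sum, h3, mul_zero]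

end IsMetricChart

/-! ### Algebraic tools for the inverse tensor and the trace -/

/-- Reduces the product of the Randers fundamental tensor and its candidate inverse, each a
three-term combination, to nine elementary pairings. -/
lemma sum_mul_expand (u₁ u₂ u₃ v₁ v₂ v₃ : Fin 4 → ℝ) (c₁ c₂ c₃ d₁ d₂ d₃ : ℝ) :
    ∑ k, (c₁ * u₁ k + c₂ * u₂ k + c₃ * u₃ k) * (d₁ * v₁ k + d₂ * v₂ k + d₃ * v₃ k) =
      c₁ * (d₁ * ∑ k, u₁ k * v₁ k + d₂ * ∑ k, u₁ k * v₂ k + d₃ * ∑ k, u₁ k * v₃ k) +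
      c₂ * (d₁ * ∑ k, u₂ k * v₁ k + d₂ * ∑ k, u₂ k * v₂ k + d₃ * ∑ k, u₂ k * v₃ k) +
      c₃ * (d₁ * ∑ k, u₃ k * v₁ k + d₂ * ∑ k, u₃ k * v₂ k + d₃ * ∑ k, u₃ k * v₃ k) := by
  simp only [Fin.sum_univ_four]
  ring

/-- The matrix of the Ricci tensor. -/
def ricciMatrix (a : E4 → Matrix (Fin 4) (Fin 4) ℝ) (x : E4) : Matrix (Fin 4) (Fin 4) ℝ :=
  Matrix.of fun l k => ricci a l k x

lemma dy_fiber (k : Fin 4) (f : LocalFun) (x y : E4) : dy k f x y = dy k (fun _ y => f x y) x y :=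
  rfl

/-- The contraction `a^{ij} S_ij`. -/
def trace (a S : Matrix (Fin 4) (Fin 4) ℝ) : ℝ := ∑ i, ∑ j, a⁻¹ i j * S i j

lemma trace_self {a : Matrix (Fin 4) (Fin 4) ℝ} (hs : ∀ i j, a i j = a j i) (ha : a.det ≠ 0) :
    trace a a = 4 := by
  have h : ∀ i, ∑ j, a⁻¹ i j * a i j = 1 := fun i => by
    have := congrFun (congrFun (Matrix.nonsing_inv_mul a ha.isUnit) i) i
    rw [Matrix.mul_apply, Matrix.one_apply_eq] at this
    rw [← this]
    exact Finset.sum_congr rfl fun j _ => by rw [hs i j]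
  simp [trace, h]

/-- A symmetric tensor whose pure-trace part is proportional to it with a factor other than the
dimension vanishes. -/
lemma eq_zero_of_quad_eq_trace {a S : Matrix (Fin 4) (Fin 4) ℝ} (ha : ∀ i j, a i j = a j i)
    (hdet : a.det ≠ 0) (hS : ∀ i j, S i j = S j i) {c : ℝ} (hc : c ≠ 0) (hc4 : c ≠ 4)
    (h : ∀ y, trace a S * quad a y - c * quad S y = 0) (i j : Fin 4) : S i j = 0 := by
  have h1 : ∀ i j, trace a S * a i j - c * S i j = 0 := by
    refine eq_zero_of_quad (a := Matrix.of fun i j => trace a S * a i j - c * S i j)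
      (fun i j => by simp [ha i j, hS i j]) fun y => ?_
    rw [← h y]
    simp only [quad, Matrix.of_apply, sub_mul, mul_assoc, Finset.sum_sub_distrib, Finset.mul_sum]
  -- The trace of `(tr S) a = c S`, using that the trace of `a` is the dimension.
  have h2 : trace a S * 4 - c * trace a S = 0 := by
    rw [← trace_self ha hdet]
    have : trace a S * trace a a - c * trace a S =
        ∑ i, ∑ j, a⁻¹ i j * (trace a S * a i j - c * S i j) := by
      simp only [mul_sub, Finset.sum_sub_distrib]
      congr 1
      · conv_lhs => rw [trace.eq_def a a]
        simp only [Finset.mul_sum]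
        exact Finset.sum_congr rfl fun i _ => Finset.sum_congr rfl fun j _ => by ring
      · conv_lhs => rw [trace]
        simp only [Finset.mul_sum]
        exact Finset.sum_congr rfl fun i _ => Finset.sum_congr rfl fun j _ => by ring
    rw [this]
    simp [h1]
  have h3 : trace a S = 0 := by
    have : (4 - c) * trace a S = 0 := by linarith
    exact (mul_eq_zero.1 this).resolve_left (sub_ne_zero.2 hc4.symm)
  have := h1 i j
  rw [h3] at this
  simpa [hc] using this

/-! ### The field equation of a Randers spacetime of Berwald type -/

namespace IsRandersChart

variable {U : Set E4} {V : Set (E4 × E4)} {a : E4 → Matrix (Fin 4) (Fin 4) ℝ}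
  {b : E4 → Fin 4 → ℝ} {F : LocalFun} (hR : IsRandersChart U V a b F) {x y : E4}

include hR

lemma fundamentalTensor_eq_randers (h : (x, y) ∈ V) (i j : Fin 4) :
    fundamentalTensor F x y i j = F x y / Real.sqrt (quad (a x) y) * a x i j +
      (lower (a x) y i / Real.sqrt (quad (a x) y) ^ 2 -
        F x y * lower (a x) y i / Real.sqrt (quad (a x) y) ^ 3 +
        b x i / Real.sqrt (quad (a x) y)) * lower (a x) y j +
      (lower (a x) y i / Real.sqrt (quad (a x) y) + b x i) * b x j := by
  have h0 := hR.sqrt_pos h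
  rw [hR.fundamentalTensor_eq h, hR.dy_eq h, hR.dy_eq h, hR.dy_dy_eq h,
    hR.metric_symm x (hR.mem_base h) j i]
  field_simp
  ring

/-- The inverse of the fundamental tensor of a Randers metric. -/
lemma inv_fundamentalTensor (h : (x, y) ∈ V) (i j : Fin 4) :
    (fundamentalTensor F x y)⁻¹ i j =
      Real.sqrt (quad (a x) y) / F x y * (a x)⁻¹ i j +
      ((lin (b x) y + Real.sqrt (quad (a x) y) * ∑ k, b x k * (a x)⁻¹.mulVec (b x) k) /
        F x y ^ 3 * y j - Real.sqrt (quad (a x) y) / F x y ^ 2 * (a x)⁻¹.mulVec (b x) j) * y i +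
      (-(Real.sqrt (quad (a x) y) / F x y ^ 2 * y j)) * (a x)⁻¹.mulVec (b x) i := by
  have hx := hR.mem_base h
  have hs := hR.metric_symm x hx
  have hdet := (hR.det_metric_ne_zero hx).isUnit
  have hsinv := matrix_inv_symm hs
  set B := (a x)⁻¹.mulVec (b x) with hB
  have hα := hR.sqrt_pos h
  have hα2 : Real.sqrt (quad (a x) y) ^ 2 = quad (a x) y := Real.sq_sqrt (hR.quad_pos h).le
  have hF := hR.ne_zero h
  have hFe := hR.eq_randers h
  have s1 : ∀ i j, ∑ k, a x i k * (a x)⁻¹ k j = if i = j then 1 else 0 := fun i j => by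
    rw [← Matrix.mul_apply, Matrix.mul_nonsing_inv _ hdet, Matrix.one_apply]
  have s2 : ∀ i, ∑ k, a x i k * y k = lower (a x) y i := fun i => rfl
  have s3 : ∀ i, ∑ k, a x i k * B k = b x i := fun i => by
    have : (a x).mulVec B i = b x i := by
      rw [hB, Matrix.mulVec_mulVec, Matrix.mul_nonsing_inv _ hdet, Matrix.one_mulVec]
    exact this
  have low : ∀ v : Fin 4 → ℝ, ∑ k, lower (a x) y k * v k = ∑ m, y m * ∑ k, a x m k * v k :=
    fun v => by
      simp only [lower, Finset.sum_mul, Finset.mul_sum]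
      rw [Finset.sum_comm]
      exact Finset.sum_congr rfl fun m _ => Finset.sum_congr rfl fun k _ => by
        rw [hs k m]
        ring
  have s4 : ∀ j, ∑ k, lower (a x) y k * (a x)⁻¹ k j = y j := fun j => by
    rw [low]
    simp [s1]
  have s5 : ∑ k, lower (a x) y k * y k = quad (a x) y := by
    rw [low]
    exact sum_mul_lower _ _
  have s6 : ∑ k, lower (a x) y k * B k = lin (b x) y := by
    rw [low]
    simp only [s3, lin]
    exact Finset.sum_congr rfl fun k _ => mul_comm _ _
  have s7 : ∀ j, ∑ k, b x k * (a x)⁻¹ k j = B j := fun j => by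
    rw [hB, Matrix.mulVec, dotProduct]
    exact Finset.sum_congr rfl fun k _ => by rw [hsinv k j, mul_comm]
  have s8 : ∑ k, b x k * y k = lin (b x) y := rfl
  set b2 := ∑ k, b x k * B k with hb2
  set α := Real.sqrt (quad (a x) y) with hαdef
  set G : Matrix (Fin 4) (Fin 4) ℝ := Matrix.of fun i j => α / F x y * (a x)⁻¹ i j +
      ((lin (b x) y + α * b2) / F x y ^ 3 * y j - α / F x y ^ 2 * B j) * y i +
      (-(α / F x y ^ 2 * y j)) * B i with hG
  have hinv : fundamentalTensor F x y * G = 1 := by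
    ext i j
    rw [Matrix.mul_apply, Matrix.one_apply]
    simp only [hR.fundamentalTensor_eq_randers h, hG, Matrix.of_apply]
    rw [sum_mul_expand, s1, s2, s3, s4, s5, s6, s7, s8, ← hb2, ← hαdef, ← hα2]
    -- With `β = F - α` and `α²` in place of the quadratic form, the entry becomes a rational
    -- identity in `F` and `α`.
    have hβ : lin (b x) y = F x y - α := by linarith
    rw [hβ]
    field_simp
    ring
  rw [Matrix.inv_eq_right_inv hinv]
  rfl

/-- The terms of the inverse that mix `y` with the dual vector of `b` drop out because `S`
annihilates that vector. -/
lemma sum_inv_fundamentalTensor_mul (h : (x, y) ∈ V) {S : Matrix (Fin 4) (Fin 4) ℝ}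
    (hS : ∀ i j, S i j = S j i) (hSb : ∀ j, ∑ i, (a x)⁻¹.mulVec (b x) i * S i j = 0) :
    ∑ i, ∑ j, ((fundamentalTensor F x y)⁻¹ i j - 3 / F x y ^ 2 * (y i * y j)) * S i j =
      Real.sqrt (quad (a x) y) / F x y * trace (a x) S +
      ((lin (b x) y + Real.sqrt (quad (a x) y) * ∑ k, b x k * (a x)⁻¹.mulVec (b x) k) /
        F x y ^ 3 - 3 / F x y ^ 2) * quad S y := by
  simp only [hR.inv_fundamentalTensor h]
  set α := Real.sqrt (quad (a x) y)
  set B := (a x)⁻¹.mulVec (b x)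
  generalize (lin (b x) y + α * ∑ k, b x k * B k) / F x y ^ 3 = k
  have e : ∀ i j, (α / F x y * (a x)⁻¹ i j + (k * y j - α / F x y ^ 2 * B j) * y i +
      -(α / F x y ^ 2 * y j) * B i - 3 / F x y ^ 2 * (y i * y j)) * S i j =
      α / F x y * ((a x)⁻¹ i j * S i j) + (k - 3 / F x y ^ 2) * (S i j * (y i * y j)) -
      α / F x y ^ 2 * (y i * (B j * S j i)) - α / F x y ^ 2 * (y j * (B i * S i j)) :=
    fun i j => by
      rw [hS j i]
      ring
  have z1 : ∑ i, ∑ j, y i * (B j * S j i) = 0 :=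
    Finset.sum_eq_zero fun i _ => by rw [← Finset.mul_sum, hSb, mul_zero]
  have z2 : ∑ i, ∑ j, y j * (B i * S i j) = 0 := by
    rw [Finset.sum_comm]
    exact z1
  have pull : ∀ (c : ℝ) (f : Fin 4 → Fin 4 → ℝ), ∑ i, ∑ j, c * f i j = c * ∑ i, ∑ j, f i j :=
    fun c f => by simp only [Finset.mul_sum]
  simp only [e, Finset.sum_add_distrib, Finset.sum_sub_distrib, pull, z1, z2]
  rw [trace, quad]
  ring

variable {Γ : Fin 4 → Fin 4 → Fin 4 → E4 → ℝ}
  (hN : ∀ {x y}, (x, y) ∈ V → ∀ i j, cartanConnection F i j x y = ∑ k, Γ i j k x * y k)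

include hN

lemma isMetricChart : IsMetricChart U a where
  isOpen := hR.isOpen_base
  smooth := hR.metric_smooth
  symm := hR.metric_symm
  det_ne_zero _ := hR.det_metric_ne_zero
  christoffel_symm x hx i j k := by
    rw [hR.christoffel_eq hN hx, hR.christoffel_eq hN hx, hR.connection_symm hN hx]
  metric_compatible x hx j m n := by
    rw [(hR.parallel_aux hN hx j).1]
    simp only [hR.christoffel_eq hN hx]

lemma form_parallel (x : E4) (hx : x ∈ U) (j m : Fin 4) :
    partialDeriv j (fun x => b x m) x = ∑ i, christoffel a i j m x * b x i := by
  rw [(hR.parallel_aux hN hx j).2]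
  simp only [hR.christoffel_eq hN hx]

lemma cartanConnection_eq_christoffel (h : (x, y) ∈ V) (i j : Fin 4) :
    cartanConnection F i j x y = ∑ k, christoffel a i j k x * y k := by
  rw [hN h]
  simp only [hR.christoffel_eq hN (hR.mem_base h)]

lemma dx_cartanConnection (h : (x, y) ∈ V) (i j k : Fin 4) :
    dx j (cartanConnection F i k) x y =
      ∑ l, partialDeriv j (christoffel a i k l) x * y l := by
  have hs : ∀ l, SmoothOn V (fun x _ => christoffel a i k l x) := fun l =>
    SmoothOn.base ((hR.isMetricChart hN).smooth_christoffel i k l) hR.mem_base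
  rw [dx_congr hR.isOpen_domain (fun h => hR.cartanConnection_eq_christoffel hN h i k) h,
    dx_sum hR.isOpen_domain (fun l => (hs l).mul (.coord l)) h]
  refine Finset.sum_congr rfl fun l _ => ?_
  rw [dx_mul hR.isOpen_domain (hs l) (.coord l) h, dx_coord, mul_zero, add_zero]
  rw [dx_base]

lemma dy_cartanConnection (h : (x, y) ∈ V) (i j k : Fin 4) :
    dy j (cartanConnection F i k) x y = christoffel a i k j x := by
  rw [dy_congr hR.isOpen_domain (fun h => hR.cartanConnection_eq_christoffel hN h i k) h, dy_fiber]
  exact dy_const_lin (fun l => christoffel a i k l x) x y j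

lemma horizontalDeriv_cartanConnection (h : (x, y) ∈ V) (i j k : Fin 4) :
    horizontalDeriv F j (cartanConnection F i k) x y =
      ∑ l, (partialDeriv j (christoffel a i k l) x -
        ∑ m, christoffel a m j l x * christoffel a i k m x) * y l := by
  simp only [horizontalDeriv, hR.dx_cartanConnection hN h, hR.dy_cartanConnection hN h,
    hR.cartanConnection_eq_christoffel hN h, sub_mul, Finset.sum_sub_distrib, Finset.sum_mul]
  rw [sub_right_inj, Finset.sum_comm]
  exact Finset.sum_congr rfl fun l _ => Finset.sum_congr rfl fun m _ => mul_right_comm _ _ _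

lemma nonlinearCurvature_eq (h : (x, y) ∈ V) (i j k : Fin 4) :
    nonlinearCurvature F i j k x y = ∑ l, riemannCurvature a l i j k x * y l := by
  have hs := (hR.isMetricChart hN).christoffel_symm x (hR.mem_base h)
  simp only [nonlinearCurvature, hR.horizontalDeriv_cartanConnection hN h,
    ← Finset.sum_sub_distrib, ← sub_mul]
  refine Finset.sum_congr rfl fun l _ => ?_
  congr 1
  simp only [riemannCurvature, Finset.sum_sub_distrib, hs i _ j, hs i _ k]
  simp only [mul_comm (christoffel a i _ _ x)]
  ring

lemma finslerRic_eq (h : (x, y) ∈ V) :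
    finslerRic F x y = quad (ricciMatrix a x) y := by
  simp only [finslerRic, hR.nonlinearCurvature_eq hN h, quad, ricci, ricciMatrix, Matrix.of_apply,
    Finset.sum_mul]
  rw [Finset.sum_comm]
  conv_rhs => rw [Finset.sum_comm]
  refine Finset.sum_congr rfl fun j _ => ?_
  rw [Finset.sum_comm]
  exact Finset.sum_congr rfl fun l _ => Finset.sum_congr rfl fun i _ => mul_assoc _ _ _

lemma ricciMatrix_symm (hx : x ∈ U) (i j : Fin 4) : ricciMatrix a x i j = ricciMatrix a x j i :=
  (hR.isMetricChart hN).ricci_symm hx i j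

/-- `Ric` is the quadratic form of the Ricci tensor of `a`. Half its Hessian is the symmetrised
tensor, so the symmetry of Ricci is essential. -/
lemma finslerRicci_eq (h : (x, y) ∈ V) (i j : Fin 4) :
    finslerRicci F i j x y = ricciMatrix a x i j := by
  have h1 : ∀ {x y}, (x, y) ∈ V → dy j (finslerRic F) x y = 2 * lower (ricciMatrix a x) y j :=
    fun {x y} h => by
      rw [dy_congr hR.isOpen_domain (hR.finslerRic_eq hN) h, dy_fiber]
      exact dy_const_quad (hR.ricciMatrix_symm hN (hR.mem_base h)) x y j
  have hs : SmoothOn Set.univ (fun _ y => lower (ricciMatrix a x) y j) :=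
    .sum fun _ _ => (SmoothOn.const _).mul (.coord _)
  rw [finslerRicci, dy_congr hR.isOpen_domain h1 h, dy_fiber,
    dy_mul isOpen_univ (.const 2) hs (Set.mem_univ (x, y)), dy_const_lower,
    dy_base (fun _ => (2 : ℝ)), hR.ricciMatrix_symm hN (hR.mem_base h) j i]
  ring

lemma fieldOperator_eq (h : (x, y) ∈ V) :
    fieldOperator F x y = Real.sqrt (quad (a x) y) / F x y * trace (a x) (ricciMatrix a x) +
      ((lin (b x) y + Real.sqrt (quad (a x) y) * ∑ k, b x k * (a x)⁻¹.mulVec (b x) k) /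
        F x y ^ 3 - 3 / F x y ^ 2) * quad (ricciMatrix a x) y := by
  have hS : ∀ j, ∑ i, (a x)⁻¹.mulVec (b x) i * ricciMatrix a x i j = 0 := fun j =>
    (hR.isMetricChart hN).sum_mul_ricci hR.form_smooth (hR.form_parallel hN) (hR.mem_base h) j
  rw [← hR.sum_inv_fundamentalTensor_mul h (hR.ricciMatrix_symm hN (hR.mem_base h)) hS]
  simp only [fieldOperator, hR.finslerRicci_eq hN h]

/-- The vacuum Finsler gravity equation at a point forces the Ricci tensor to vanish there. -/
lemma ricci_eq_zero (hx : x ∈ U) (hf : ∀ y, (x, y) ∈ V → fieldOperator F x y = 0) (i j : Fin 4) :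
    ricci a i j x = 0 := by
  change ricciMatrix a x i j = 0
  set S := ricciMatrix a x with hS
  have hSs : ∀ i j, S i j = S j i := hR.ricciMatrix_symm hN hx
  set R := trace (a x) S with hRdef
  set b2 := ∑ k, b x k * (a x)⁻¹.mulVec (b x) k with hb2
  have hq := analyticAt_quad (a x)
  have hβ := analyticAt_lin (b x)
  have hSq := analyticAt_quad S
  -- After multiplication by `F³` and substitution of `F = α + β`, `f` collects the even powers of
  -- `α`, and `α g` the odd ones.
  have key := hR.eq_zero_of_add_sqrt_mul hx
    (f := fun y => 2 * lin (b x) y * (R * quad (a x) y - 1 * quad S y))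
    (g := fun y => (quad (a x) y + lin (b x) y ^ 2) * R + (b2 - 3) * quad S y)
    (fun y => (analyticAt_const.mul (hβ y)).mul
      ((analyticAt_const.mul (hq y)).sub (analyticAt_const.mul (hSq y))))
    (fun y => (((hq y).add ((hβ y).pow 2)).mul analyticAt_const).add
      (analyticAt_const.mul (hSq y)))
    fun y h => by
      have h1 := hf y h
      rw [hR.fieldOperator_eq hN h, ← hS, ← hRdef, ← hb2] at h1
      have hF := hR.ne_zero h
      have hFe := hR.eq_randers h
      have hα2 : Real.sqrt (quad (a x) y) ^ 2 = quad (a x) y := Real.sq_sqrt (hR.quad_pos h).le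
      set α := Real.sqrt (quad (a x) y)
      have h2 : α * F x y ^ 2 * R + (lin (b x) y + α * b2 - 3 * F x y) * quad S y = 0 := by
        field_simp at h1
        linear_combination h1
      rw [hFe] at h2
      rw [← hα2]
      linear_combination h2
  -- If `b = 0` at this point, `f` is identically zero and `g` gives `(tr S) a = 3 S`. Otherwise `f`
  -- gives `(tr S) a = S` on the open set `β ≠ 0`, hence everywhere by analyticity.
  by_cases hb : b x = 0
  · have hlin : ∀ y, lin (b x) y = 0 := fun y => by simp [hb, lin]
    have hb2' : b2 = 0 := by simp [hb2, hb]
    refine eq_zero_of_quad_eq_trace (hR.metric_symm x hx) (hR.det_metric_ne_zero hx) hSs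
      (c := 3) (by norm_num) (by norm_num) (fun y => ?_) i j
    have := key.2 y
    rw [hlin, hb2'] at this
    linear_combination this
  · obtain ⟨k, hk⟩ := Function.ne_iff.1 hb
    have hcont : Continuous (lin (b x)) := continuous_iff_continuousAt.2 fun y => (hβ y).continuousAt
    refine eq_zero_of_quad_eq_trace (hR.metric_symm x hx) (hR.det_metric_ne_zero hx) hSs
      (c := 1) (by norm_num) (by norm_num) (fun y => ?_) i j
    refine eq_zero_of_analytic (O := {y | lin (b x) y ≠ 0})
      (f := fun y => R * quad (a x) y - 1 * quad S y)
      (fun y => (analyticAt_const.mul (hq y)).sub (analyticAt_const.mul (hSq y)))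
      (isOpen_ne_fun hcont continuous_const) ⟨EuclideanSpace.single k 1, ?_⟩ (fun y hy => ?_) y
    · simpa [lin_single] using hk
    · have := key.1 y
      simpa [hy.out] using this

end IsRandersChart

end FinslerGravity

end

theorem mainTheorem3 {M : Type*} [TopologicalSpace M] [ChartedSpace FinslerGravity.E4 M]
    [IsManifold 𝓘(ℝ, FinslerGravity.E4) ∞ M]
    (S : FinslerGravity.FinslerSpacetime M) (a : FinslerGravity.LorentzianMetric M)
    (b : FinslerGravity.OneForm M) (hRanders : S.IsRanders a b) (hBerwald : S.IsBerwald) :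
    S.SolvesVacuumFinslerGravity ↔ a.SolvesVacuumEinstein := by
  constructor
  · intro h φ hφ x hx i j
    obtain ⟨Γ, hΓ⟩ := hBerwald φ hφ
    exact (FinslerGravity.isRandersChart S a b hRanders hφ).ricci_eq_zero
      (fun h i j => hΓ _ h.1 _ h.2 i j) hx (fun y hy => h φ hφ x hx y hy.2) i j
  · intro h φ hφ x hx y hy
    obtain ⟨Γ, hΓ⟩ := hBerwald φ hφ
    have h1 := FinslerGravity.IsRandersChart.finslerRicci_eq
      (FinslerGravity.isRandersChart S a b hRanders hφ) (fun h i j => hΓ _ h.1 _ h.2 i j)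
      (x := x) (y := y) ⟨hx, hy⟩
    -- Each `R_ij` vanishes, so the contraction is zero whatever its coefficients are.
    simp [FinslerGravity.fieldOperator, h1, FinslerGravity.ricciMatrix, h φ hφ x hx]
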